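/- **Model.** Let $N\in\mathbb{N}$, let $A$ be a Borel space (a Borel subset of a Polish space) which is a subset of a real vector space, $\mathcal Z$ a measurable space, $q\in(1,\infty]$ and $\frac1p+\frac1q=1$. For $n=0,\dots,N-1$ let $\mathbb P_{n+1}$ be a separable probability measure on $\mathcal Z$, $D_n\subseteq\mathbb R\times A$ a measurable set containing the graph of a measurable map $\mathbb R\to A$, with sections $D_n(x)=\{a:(x,a)\in D_n\}$, $T_n:D_n\times\mathcal Z\to\mathbb R$ measurable, $c_n:D_n\times\mathbb R\to\mathbb R$, $c_N:\mathbb R\to\mathbb R$. Let $\mathcal Q_{n+1}$ be a non-empty set of probability measures $\mathbb Q\ll\mathbb P_{n+1}$ with $\frac{d\mathbb Q}{d\mathbb P_{n+1}}\in L^q(\mathbb P_{n+1})$. It is identified with its set of densities and carries the weak* topology $\sigma(L^q,L^p)$ and the Borel $\sigma$-algebra of that topology. Below, $Z_{n+1}$ denotes the disturbance, i.e. the identity on $\mathcal Z$. **Assumptions.** (1) There are $\alpha,\underline\epsilon,\bar\epsilon\ge0$ with $\underline\epsilon+\bar\epsilon=1$, $\alpha\ne1$, and measurable $\underline b:\mathbb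 R\to(-\infty,-\underline\epsilon]$, $\bar b:\mathbb R\to[\bar\epsilon,\infty)$ such that for all $n$, $\mathbb Q\in\mathcal Q_{n+1}$, $(x,a)\in D_n$: $\mathbb E^{\mathbb Q}[-c_n^-(x,a,T_n(x,a,Z_{n+1}))]\ge\underline b(x)$, $\mathbb E^{\mathbb Q}[\underline b(T_n(x,a,Z_{n+1}))]\ge\alpha\underline b(x)$, $\mathbb E^{\mathbb Q}[c_n^+(x,a,T_n(x,a,Z_{n+1}))]\le\bar b(x)$, $\mathbb E^{\mathbb Q}[\bar b(T_n(x,a,Z_{n+1}))]\le\alpha\bar b(x)$; and $\underline b\le c_N\le\bar b$. Put $b=\bar b-\underline b$. (2) Every $(\bar x,\bar a)\in D_n$ has a neighbourhood $U$ in $D_n$ and measurable $\Theta_1,\Theta_2:\mathcal Z\to\mathbb R_+$ in $L^p(\mathbb P_{n+1})$ with $|c_n(x,a,T_n(x,a,z))|\le\Theta_1(z)$ and $b(T_n(x,a,z))\le\Theta_2(z)$ for all $(x,a)\in U$, $z\in\mathcal Z$. (3) The densities of the measures in $\mathcal Q_{n+1}$ are bounded in $L^q$-norm, uniformly in $n$.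 (4) The sets $D_n(x)$ are compact, and $x_k\to x$, $a_k\in D_n(x_k)$ imply that $(a_k)$ has an accumulation point in $D_n(x)$. $T_n(\cdot,\cdot,z)$ is lower semicontinuous on $D_n$ for every $z$; $c_n$ and $c_N$ are lower semicontinuous. (5) $x\le y$ implies $D_n(y)\subseteq D_n(x)$; $x\mapsto T_n(x,a,z)$, $(x,x')\mapsto c_n(x,a,x')$ and $c_N$ are increasing. (6) (Convex model) $D_n$ is convex, and $(x,a)\mapsto T_n(x,a,z)$, $(x,a,x')\mapsto c_n(x,a,x')$ and $c_N$ are convex. (7) The sets $\mathcal Q_{n+1}$ are convex and weak* closed in $L^q(\mathbb P_{n+1})$. **Values.** Let $\Pi(\mathbb R)$ and $\Pi(\mathbb R,\mathcal Q)$ be the sets of sequences $\pi=(d_0,\dots,d_{N-1})$ of measurable $d_n:\mathbb R\to A$ with $d_n(x)\in D_n(x)$, respectively of measurable $d_n:\mathbb R\times\mathcal Q_{n+1}\to A$ with $d_n(x,\mathbb Q)\in D_n(x)$. Let $\Gamma(\mathbb R)$ and $\Gamma(\mathbb R,A)$ be the sets of sequences $\gamma=(\gamma_0,\dots,\gamma_{N-1})$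 of measurable $\gamma_n:\mathbb R\to\mathcal Q_{n+1}$, respectively $\gamma_n:\mathbb R\times A\to\mathcal Q_{n+1}$. For $(\pi,\gamma)\in\Pi(\mathbb R)\times\Gamma(\mathbb R,A)$, in state $X_n=x$ the action is $A_n=d_n(x)$ and $Z_{n+1}$ has law $\gamma_n(x,A_n)$; for $(\pi,\gamma)\in\Pi(\mathbb R,\mathcal Q)\times\Gamma(\mathbb R)$, $Z_{n+1}$ has law $\gamma_n(x)$ and $A_n=d_n(x,\gamma_n(x))$. In both cases $X_{n+1}=T_n(X_n,A_n,Z_{n+1})$. Let $$J_{n\pi\gamma}(x)=\mathbb E^{\pi\gamma}\Big[\sum_{k=n}^{N-1}c_k(X_k,A_k,X_{k+1})+c_N(X_N)\,\Big|\,X_n=x\Big],$$ $$J_n(x)=\inf_{\pi\in\Pi(\mathbb R)}\sup_{\gamma\in\Gamma(\mathbb R,A)}J_{n\pi\gamma}(x),\qquad \widetilde J_{n\gamma}(x)=\inf_{\pi\in\Pi(\mathbb R,\mathcal Q)}J_{n\pi\gamma}(x),\qquad \widetilde J_n(x)=\sup_{\gamma\in\Gamma(\mathbb R)}\widetilde J_{n\gamma}(x).$$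 Let $L_nv(x,a,\mathbb Q)=\int c_n(x,a,T_n(x,a,z))+v(T_n(x,a,z))\,\mathbb Q(dz)$, and let $\mathbb B$ be the set of measurable, lower semicontinuous, increasing $v:\mathbb R\to\mathbb R$ with $|v|\le\lambda b$ for some $\lambda\ge0$. **Theorem.** Under (1)–(7): (a) For $n=0,\dots,N$, $\widetilde J_n$ is real-valued and belongs to $\mathbb B$, $\widetilde J_N=c_N$, and for $n<N$, $x\in\mathbb R$, $$\widetilde J_n(x)=\sup_{\mathbb Q\in\mathcal Q_{n+1}}\inf_{a\in D_n(x)}L_n\widetilde J_{n+1}(x,a,\mathbb Q).$$ There are $\tilde\gamma\in\Gamma(\mathbb R)$ and $\tilde\pi=(\tilde d_n)\in\Pi(\mathbb R,\mathcal Q)$ such that for all $n<N$ and $x$, $\mathbb Q=\tilde\gamma_n(x)$ attains the supremum, and for all $n<N$, $x$ and $\mathbb Q\in\mathcal Q_{n+1}$, $a=\tilde d_n(x,\mathbb Q)$ attains the infimum; in particular $$\widetilde J_n(x)=L_n\widetilde J_{n+1}\big(x,\tilde d_n(x,\tilde\gamma_n(x)),\tilde\gamma_n(x)\big)\quad\text{for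 all }n<N,\ x\in\mathbb R.\qquad(*)$$ Every pair $(\tilde\pi,\tilde\gamma)\in\Pi(\mathbb R,\mathcal Q)\times\Gamma(\mathbb R)$ with $(*)$ satisfies $\widetilde J_n=J_{n\tilde\pi\tilde\gamma}$ for $n=0,\dots,N$. (b) $J_n=\widetilde J_n=\widetilde J_{n\tilde\gamma}$ for $n=0,\dots,N$ and for every $\tilde\gamma\in\Gamma(\mathbb R)$ such that $\tilde\gamma_n(x)$ attains the supremum in the Bellman equation for all $n<N$ and $x\in\mathbb R$. -/

import Mathlib

open MeasureTheory ProbabilityTheory Filter Topology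
open scoped ENNReal

noncomputable section

/-- The topology `σ(L^q, L^p)` on `L^q(P)`: the coarsest one for which all the maps
`f ↦ ∫ f g dP`, `g ∈ L^p(P)`, are continuous. -/
@[reducible] def weakStarTopology {Z : Type*} [MeasurableSpace Z] (P : Measure Z) (p q : ℝ≥0∞) :
    TopologicalSpace (Lp ℝ q P) :=
  ⨅ g : Lp ℝ p P, TopologicalSpace.induced (fun f : Lp ℝ q P => ∫ z, f z * g z ∂P) inferInstance

/-- Data of a distributionally robust Markov decision model with state space `ℝ`, action space `A`,
disturbance space `Z` and planning horizon `N`. Stages are indexed by `n : Fin N`; `P n` is the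
reference law of the disturbance `Z_{n+1}` and `Q n` the ambiguity set for that law.
The maps `T n` and `c n` are only used at state-action pairs in `D n`. A probability measure which
is absolutely continuous with respect to `P n` with density in `L^q` is identified with its
density. -/
structure RobustMDP (A Z : Type*) [MeasurableSpace A] [MeasurableSpace Z] (N : ℕ)
    (p q : ℝ≥0∞) where
  holder : ENNReal.HolderConjugate p q
  one_lt_q : 1 < q
  P : Fin N → Measure Z
  prob : ∀ n, IsProbabilityMeasure (P n)
  separable : ∀ n, IsSeparable (P n)
  D : Fin N → Set (ℝ × A)
  measurableSet_D : ∀ n, MeasurableSet (D n)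
  exists_selector : ∀ n, ∃ f : ℝ → A, Measurable f ∧ ∀ x, (x, f x) ∈ D n
  T : Fin N → ℝ → A → Z → ℝ
  measurable_T : ∀ n, Measurable (fun w : D n × Z => T n w.1.1.1 w.1.1.2 w.2)
  c : Fin N → ℝ → A → ℝ → ℝ
  cN : ℝ → ℝ
  Q : ∀ n, Set (Lp ℝ q (P n))
  Q_nonempty : ∀ n, (Q n).Nonempty
  Q_density : ∀ n, ∀ f ∈ Q n, (∀ᵐ z ∂(P n), 0 ≤ f z) ∧ ∫ z, f z ∂(P n) = 1

namespace RobustMDP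

variable {A Z : Type*} [MeasurableSpace A] [MeasurableSpace Z] {N : ℕ} {p q : ℝ≥0∞}

/-- The ambiguity set as a space of its own. -/
def Amb (M : RobustMDP A Z N p q) (n : Fin N) : Type _ := ↥(M.Q n)

/-- The trace of the weak* topology. -/
instance (M : RobustMDP A Z N p q) (n : Fin N) : TopologicalSpace (M.Amb n) :=
  TopologicalSpace.induced (fun f : M.Amb n => f.1) (weakStarTopology (M.P n) p q)

/-- The Borel `σ`-algebra of the weak* topology. -/
instance (M : RobustMDP A Z N p q) (n : Fin N) : MeasurableSpace (M.Amb n) :=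
  borel (M.Amb n)

/-- The probability measure with the given density. -/
def law (M : RobustMDP A Z N p q) {n : Fin N} (f : M.Amb n) : Measure Z :=
  (M.P n).withDensity (fun z => ENNReal.ofReal (f.1 z))

lemma integrable_density (M : RobustMDP A Z N p q) {n : Fin N} (f : M.Amb n) :
    Integrable (fun z => f.1 z) (M.P n) := by
  have := M.prob n
  exact (Lp.memLp f.1).integrable M.one_lt_q.le

lemma law_apply (M : RobustMDP A Z N p q) {n : Fin N} (f : M.Amb n) {B : Set Z}
    (hB : MeasurableSet B) : M.law f B = ENNReal.ofReal (∫ z in B, f.1 z ∂(M.P n)) := by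
  rw [law, withDensity_apply _ hB, ofReal_integral_eq_lintegral_ofReal
    (M.integrable_density f).integrableOn (ae_restrict_of_ae (M.Q_density n f.1 f.2).1)]

lemma isProbabilityMeasure_law (M : RobustMDP A Z N p q) {n : Fin N} (f : M.Amb n) :
    IsProbabilityMeasure (M.law f) := by
  refine ⟨?_⟩
  rw [M.law_apply f MeasurableSet.univ, Measure.restrict_univ, (M.Q_density n f.1 f.2).2,
    ENNReal.ofReal_one]

lemma measurable_law (M : RobustMDP A Z N p q) (n : Fin N) :
    Measurable (fun f : M.Amb n => M.law f) := by
  have := M.prob n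
  refine Measure.measurable_of_measurable_coe _ fun B hB => ?_
  have hfun : (fun f : M.Amb n => M.law f B) = fun f : M.Amb n => ENNReal.ofReal
      (∫ z, f.1 z * (indicatorConstLp p hB (measure_ne_top (M.P n) B) (1 : ℝ)) z ∂(M.P n)) := by
    funext f
    rw [M.law_apply f hB, ← integral_indicator hB]
    congr 1
    refine integral_congr_ae ?_
    filter_upwards [indicatorConstLp_coeFn (p := p) (hs := hB)
      (hμs := measure_ne_top (M.P n) B) (c := (1 : ℝ))] with z hz
    rw [hz]
    by_cases h : z ∈ B <;> simp [h]
  rw [hfun]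
  refine ENNReal.measurable_ofReal.comp ?_
  have hc : Continuous (fun f : M.Amb n =>
      ∫ z, f.1 z * (indicatorConstLp p hB (measure_ne_top (M.P n) B) (1 : ℝ)) z ∂(M.P n)) := by
    have h1 : @Continuous _ _ (weakStarTopology (M.P n) p q) _ (fun f : Lp ℝ q (M.P n) =>
        ∫ z, f z * (indicatorConstLp p hB (measure_ne_top (M.P n) B) (1 : ℝ)) z ∂(M.P n)) :=
      continuous_iff_le_induced.2 (iInf_le _ _)
    exact @Continuous.comp _ _ _ _ (weakStarTopology (M.P n) p q) _ _ _ h1 continuous_induced_dom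
  have : BorelSpace (M.Amb n) := ⟨rfl⟩
  exact hc.measurable

/-- Deterministic Markov behaviour of both players: in state `x` at stage `n` the action `act n x`
is taken and nature uses the disturbance law `amb n x`. -/
structure Profile (M : RobustMDP A Z N p q) where
  act : Fin N → ℝ → A
  amb : ∀ n : Fin N, ℝ → M.Amb n
  measurable_act : ∀ n, Measurable (act n)
  measurable_amb : ∀ n, Measurable (amb n)
  act_mem : ∀ n x, (x, act n x) ∈ M.D n

/-- Next state as a function of the present state and the disturbance. -/
def Profile.next {M : RobustMDP A Z N p q} (σ : M.Profile) (n : Fin N) (w : ℝ × Z) : ℝ :=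
  M.T n w.1 (σ.act n w.1) w.2

lemma Profile.measurable_next {M : RobustMDP A Z N p q} (σ : M.Profile) (n : Fin N) :
    Measurable (σ.next n) :=
  (M.measurable_T n).comp
    (f := fun w : ℝ × Z => ((⟨(w.1, σ.act n w.1), σ.act_mem n w.1⟩ : M.D n), w.2))
    ((Measurable.subtype_mk
      (measurable_fst.prodMk ((σ.measurable_act n).comp measurable_fst))).prodMk measurable_snd)

/-- Conditional law of the disturbance given the present state. -/
def Profile.disturbance {M : RobustMDP A Z N p q} (σ : M.Profile) (n : Fin N) : Kernel ℝ Z where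
  toFun x := M.law (σ.amb n x)
  measurable' := (M.measurable_law n).comp (σ.measurable_amb n)

instance {M : RobustMDP A Z N p q} (σ : M.Profile) (n : Fin N) :
    IsMarkovKernel (σ.disturbance n) :=
  ⟨fun x => M.isProbabilityMeasure_law (σ.amb n x)⟩

/-- One-stage transition kernel: the law of `T n x a z` with `a = act n x` and `z` distributed
according to `amb n x`. -/
def Profile.step {M : RobustMDP A Z N p q} (σ : M.Profile) (n : Fin N) : Kernel ℝ ℝ :=
  (Kernel.id ×ₖ σ.disturbance n).map (σ.next n)

instance {M : RobustMDP A Z N p q} (σ : M.Profile) (n : Fin N) : IsMarkovKernel (σ.step n) :=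
  Kernel.IsMarkovKernel.map _ (σ.measurable_next n)

/-- The transition kernels as functions of the state history; after the horizon `N` the state
stays where it is. -/
def Profile.kernel {M : RobustMDP A Z N p q} (σ : M.Profile) (k : ℕ) :
    Kernel ((i : Finset.Iic k) → ℝ) ℝ :=
  (if h : k < N then σ.step ⟨k, h⟩ else Kernel.id).comap
    (fun h => h ⟨k, Finset.mem_Iic.2 le_rfl⟩) (measurable_pi_apply _)

instance {M : RobustMDP A Z N p q} (σ : M.Profile) (k : ℕ) : IsMarkovKernel (σ.kernel k) := by
  unfold Profile.kernel
  split_ifs <;> infer_instance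

/-- Law (Ionescu-Tulcea) of the state process given `X_n = x`. The states before time `n` play no
role and are set to `x`. -/
def Profile.pathLaw {M : RobustMDP A Z N p q} (σ : M.Profile) (n : ℕ) (x : ℝ) : Measure (ℕ → ℝ) :=
  Kernel.traj (X := fun _ => ℝ) σ.kernel n (fun _ => x)

/-- Total cost from stage `n` on, along the state trajectory `ω`. -/
def Profile.totalCost {M : RobustMDP A Z N p q} (σ : M.Profile) (n : ℕ) (ω : ℕ → ℝ) : ℝ :=
  (∑ k ∈ Finset.univ.filter (fun k : Fin N => n ≤ (k : ℕ)), M.c k (ω k) (σ.act k (ω k)) (ω (k + 1))) +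
    M.cN (ω N)

/-- Conditional expectation of the total cost from stage `n` on, given `X_n = x`. (Under the
integrability assumptions below the total cost is integrable for every profile.) -/
def Profile.value {M : RobustMDP A Z N p q} (σ : M.Profile) (n : ℕ) (x : ℝ) : ℝ :=
  ∫ ω, σ.totalCost n ω ∂(σ.pathLaw n x)

/-- Controller's Markov policies, `d_n : ℝ → A`. -/
structure LeaderController (M : RobustMDP A Z N p q) where
  rule : Fin N → ℝ → A
  measurable_rule : ∀ n, Measurable (rule n)
  rule_mem : ∀ n x, (x, rule n x) ∈ M.D n

/-- Controller's policies reacting to nature, `d_n : ℝ × Q_{n+1} → A`. -/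
structure FollowerController (M : RobustMDP A Z N p q) where
  rule : ∀ n : Fin N, ℝ × M.Amb n → A
  measurable_rule : ∀ n, Measurable (rule n)
  rule_mem : ∀ n x f, (x, rule n (x, f)) ∈ M.D n

/-- Nature's policies not depending on the action, `γ_n : ℝ → Q_{n+1}`. -/
structure LeaderNature (M : RobustMDP A Z N p q) where
  rule : ∀ n : Fin N, ℝ → M.Amb n
  measurable_rule : ∀ n, Measurable (rule n)

/-- Nature's Markov policies reacting to the controller, `γ_n : ℝ × A → Q_{n+1}`. -/
structure FollowerNature (M : RobustMDP A Z N p q) where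
  rule : ∀ n : Fin N, ℝ × A → M.Amb n
  measurable_rule : ∀ n, Measurable (rule n)

/-- Behaviour resulting from a policy pair when the controller moves first. -/
def controllerFirst {M : RobustMDP A Z N p q} (π : M.LeaderController) (γ : M.FollowerNature) :
    M.Profile where
  act := π.rule
  amb n x := γ.rule n (x, π.rule n x)
  measurable_act := π.measurable_rule
  measurable_amb n := (γ.measurable_rule n).comp (measurable_id.prodMk (π.measurable_rule n))
  act_mem := π.rule_mem

/-- Behaviour resulting from a policy pair when nature moves first. -/
def natureFirst {M : RobustMDP A Z N p q} (π : M.FollowerController) (γ : M.LeaderNature) :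
    M.Profile where
  act n x := π.rule n (x, γ.rule n x)
  amb := γ.rule
  measurable_act n := (π.measurable_rule n).comp (measurable_id.prodMk (γ.measurable_rule n))
  measurable_amb := γ.measurable_rule
  act_mem n x := π.rule_mem n x (γ.rule n x)

/-- Robust value function `J_n(x) = inf_π sup_γ J_{nπγ}(x)`, where the controller moves first. -/
def robustValue (M : RobustMDP A Z N p q) (n : ℕ) (x : ℝ) : EReal :=
  ⨅ π : M.LeaderController, ⨆ γ : M.FollowerNature, ((controllerFirst π γ).value n x : EReal)

/-- Value of a policy of nature when nature moves first, `inf_π J_{nπγ}(x)`. -/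
def naturePolicyValue {M : RobustMDP A Z N p q} (γ : M.LeaderNature) (n : ℕ) (x : ℝ) : EReal :=
  ⨅ π : M.FollowerController, ((natureFirst π γ).value n x : EReal)

/-- Value function of the game where nature moves first. -/
def natureFirstValue (M : RobustMDP A Z N p q) (n : ℕ) (x : ℝ) : EReal :=
  ⨆ γ : M.LeaderNature, naturePolicyValue γ n x

/-- `(L_n v)(x, a, Q)`. -/
def L (M : RobustMDP A Z N p q) (n : Fin N) (v : ℝ → ℝ) (x : ℝ) (a : A) (f : M.Amb n) : ℝ :=
  ∫ z, (M.c n x a (M.T n x a z) + v (M.T n x a z)) ∂(M.law f)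

/-- `inf_{a ∈ D_n(x)} (L_n v)(x, a, Q)`. -/
def infL (M : RobustMDP A Z N p q) (n : Fin N) (v : ℝ → ℝ) (x : ℝ) (f : M.Amb n) : EReal :=
  ⨅ a : {a : A // (x, a) ∈ M.D n}, (M.L n v x a.1 f : EReal)

/-- The sup-inf Bellman operator. -/
def supInf (M : RobustMDP A Z N p q) (n : Fin N) (v : ℝ → ℝ) (x : ℝ) : EReal :=
  ⨆ f : M.Amb n, M.infL n v x f

/-- The integrability assumptions with lower bounding function `blo` and upper bounding function
`bhi`. Since `blo ≤ 0 ≤ bhi`, all expectations in them are expressed as lower Lebesgue integrals of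
nonnegative functions; `ENNReal.ofReal` takes positive parts. -/
structure BoundingAssumption [TopologicalSpace A] (M : RobustMDP A Z N p q) (blo bhi : ℝ → ℝ) :
    Prop where
  measurable_blo : Measurable blo
  measurable_bhi : Measurable bhi
  bounds : ∃ α εlo εhi : ℝ, 0 ≤ α ∧ 0 ≤ εlo ∧ 0 ≤ εhi ∧ εlo + εhi = 1 ∧ α ≠ 1 ∧
    (∀ x, blo x ≤ -εlo) ∧ (∀ x, εhi ≤ bhi x) ∧
    ∀ (n : Fin N) (f : M.Amb n) (x : ℝ) (a : A), (x, a) ∈ M.D n →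
      ∫⁻ z, ENNReal.ofReal (-(M.c n x a (M.T n x a z))) ∂(M.law f) ≤ ENNReal.ofReal (-(blo x)) ∧
      ∫⁻ z, ENNReal.ofReal (-(blo (M.T n x a z))) ∂(M.law f) ≤ ENNReal.ofReal (-(α * blo x)) ∧
      ∫⁻ z, ENNReal.ofReal (M.c n x a (M.T n x a z)) ∂(M.law f) ≤ ENNReal.ofReal (bhi x) ∧
      ∫⁻ z, ENNReal.ofReal (bhi (M.T n x a z)) ∂(M.law f) ≤ ENNReal.ofReal (α * bhi x)
  terminal : ∀ x, blo x ≤ M.cN x ∧ M.cN x ≤ bhi x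
  locallyDominated : ∀ (n : Fin N) (w₀ : ℝ × A), w₀ ∈ M.D n → ∃ Θ₁ Θ₂ : Z → ℝ,
    Measurable Θ₁ ∧ Measurable Θ₂ ∧ (∀ z, 0 ≤ Θ₁ z) ∧ (∀ z, 0 ≤ Θ₂ z) ∧
    MemLp Θ₁ p (M.P n) ∧ MemLp Θ₂ p (M.P n) ∧
    ∀ᶠ w in 𝓝[M.D n] w₀, ∀ z,
      |M.c n w.1 w.2 (M.T n w.1 w.2 z)| ≤ Θ₁ z ∧
      bhi (M.T n w.1 w.2 z) - blo (M.T n w.1 w.2 z) ≤ Θ₂ z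
  normBounded : ∃ K : ℝ, ∀ (n : Fin N), ∀ f ∈ M.Q n, ‖f‖ ≤ K

/-- Semicontinuity, compactness and monotonicity assumptions for the state space `ℝ`. -/
structure RealAssumption [TopologicalSpace A] (M : RobustMDP A Z N p q) : Prop where
  compact_D : ∀ n x, IsCompact {a : A | (x, a) ∈ M.D n}
  usc_D : ∀ (n : Fin N) (x : ℝ) (u : ℕ → ℝ) (a : ℕ → A), Tendsto u atTop (𝓝 x) →
    (∀ k, (u k, a k) ∈ M.D n) → ∃ b, (x, b) ∈ M.D n ∧ MapClusterPt b atTop a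
  lsc_T : ∀ n z, LowerSemicontinuousOn (fun w : ℝ × A => M.T n w.1 w.2 z) (M.D n)
  lsc_c : ∀ n, LowerSemicontinuousOn (fun w : (ℝ × A) × ℝ => M.c n w.1.1 w.1.2 w.2)
    (M.D n ×ˢ Set.univ)
  lsc_cN : LowerSemicontinuous M.cN
  antitone_D : ∀ (n : Fin N) (x y : ℝ) (a : A), x ≤ y → (y, a) ∈ M.D n → (x, a) ∈ M.D n
  mono_T : ∀ (n : Fin N) (x y : ℝ) (a : A) (z : Z), x ≤ y → (x, a) ∈ M.D n → (y, a) ∈ M.D n →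
    M.T n x a z ≤ M.T n y a z
  mono_c : ∀ (n : Fin N) (x y x' y' : ℝ) (a : A), x ≤ y → x' ≤ y' → (x, a) ∈ M.D n →
    (y, a) ∈ M.D n → M.c n x a x' ≤ M.c n y a y'
  mono_cN : Monotone M.cN

/-- Convexity of the model, where `A` is regarded as a subset of the real vector space `V` through
the injection `ι`. No compatibility of the topology of `A` with `V` is required. -/
structure ConvexModel {V : Type*} [AddCommGroup V] [Module ℝ V] (M : RobustMDP A Z N p q)
    (ι : A → V) : Prop where
  injective : Function.Injective ι
  convex_D : ∀ n, Convex ℝ ((fun w : ℝ × A => (w.1, ι w.2)) '' M.D n)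
  convex_T : ∀ (n : Fin N) (z : Z), ∀ w₁ ∈ M.D n, ∀ w₂ ∈ M.D n, ∀ w ∈ M.D n, ∀ s t : ℝ,
    0 ≤ s → 0 ≤ t → s + t = 1 → w.1 = s * w₁.1 + t * w₂.1 → ι w.2 = s • ι w₁.2 + t • ι w₂.2 →
    M.T n w.1 w.2 z ≤ s * M.T n w₁.1 w₁.2 z + t * M.T n w₂.1 w₂.2 z
  convex_c : ∀ (n : Fin N), ∀ w₁ ∈ M.D n, ∀ w₂ ∈ M.D n, ∀ w ∈ M.D n, ∀ x₁ x₂ s t : ℝ,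
    0 ≤ s → 0 ≤ t → s + t = 1 → w.1 = s * w₁.1 + t * w₂.1 → ι w.2 = s • ι w₁.2 + t • ι w₂.2 →
    M.c n w.1 w.2 (s * x₁ + t * x₂) ≤ s * M.c n w₁.1 w₁.2 x₁ + t * M.c n w₂.1 w₂.2 x₂
  convex_cN : ConvexOn ℝ Set.univ M.cN

/-- The ambiguity sets are closed in `L^q` for the weak* topology. -/
def WeakStarClosed (M : RobustMDP A Z N p q) : Prop :=
  ∀ n, @IsClosed _ (weakStarTopology (M.P n) p q) (M.Q n)

/-- The set `𝔹` of lower semicontinuous increasing functions bounded by a multiple of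
`b = bhi - blo`. -/
def valueSpace (blo bhi : ℝ → ℝ) : Set (ℝ → ℝ) :=
  {v | Measurable v ∧ (∃ lam : ℝ, 0 ≤ lam ∧ ∀ x, |v x| ≤ lam * (bhi x - blo x)) ∧
    LowerSemicontinuous v ∧ Monotone v}

end RobustMDP

end

/-! The functions `v N = cN`, `v n x = sup_Q inf_a L_n (v (n+1)) x a Q` are shown to be the values
of both games. Two facts carry this: one backward step stays within the convex members of
`valueSpace` and comes with measurable optimal rules (`exists_bellmanStep`), and the gap between `v`
and the value of any profile is an expected sum of one-stage gaps (`Profile.sub_value_eq`).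

For the backward step, the stage cost at a fixed pair `(x, a)` lies in `L^p`, so `L` is weak*
continuous in the law. Jointly in state, law and action it is lower semicontinuous: downward
deviations of the stage cost near a point vanish in `L^p`, and the densities are norm bounded
(`lowerSemicontinuousOn_L`). The ambiguity sets are weak* compact, by Tychonoff's theorem and Riesz
representation of positive functionals, and metrizable because `L^p` is separable. Hence both optima
are attained, and measurable selection yields rules. Since `L` is convex in the action and affine in
the law, a minimax theorem gives the controller a rule that guarantees `v n` without knowing the law
(`exists_minimax_rule`). This is why convexity must be carried through the recursion.

For the verification, the gap `v k - L_k (v (k+1))` is nonnegative when the controller uses the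
reply or the robust rule, and nonpositive when nature uses a maximizer. So replies bound the
nature-first value above by `v`, the robust rule does the same for the robust value, and maximizers
of nature give the lower bound. The nature-first value never exceeds the robust value, because a
player may ignore the opponent's move. -/

/-! ### Measurable selection of optimizers. -/

section Selection

variable {X A : Type*} [MeasurableSpace X] [TopologicalSpace A]

/-- The minimizers of `φ x` over `K x`. -/
def argminOn (K : X → Set A) (φ : X → A → ℝ) (x : X) : Set A :=
  {a ∈ K x | ∀ b ∈ K x, φ x a ≤ φ x b}

omit [MeasurableSpace X] in
lemma argminOn_nonempty {K : X → Set A} {φ : X → A → ℝ} {x : X} (hne : (K x).Nonempty)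
    (hc : IsCompact (K x)) (hφ : LowerSemicontinuousOn (φ x) (K x)) :
    (argminOn K φ x).Nonempty := by
  obtain ⟨a, ha, h⟩ := hφ.exists_isMinOn hne hc
  exact ⟨a, ha, fun b hb => h hb⟩

omit [MeasurableSpace X] in
lemma isCompact_argminOn {K : X → Set A} {φ : X → A → ℝ} {x : X} (hne : (K x).Nonempty)
    (hc : IsCompact (K x)) (hφ : LowerSemicontinuousOn (φ x) (K x)) :
    IsCompact (argminOn K φ x) := by
  obtain ⟨a, ha, h⟩ := argminOn_nonempty hne hc hφ
  have : argminOn K φ x = K x ∩ φ x ⁻¹' Set.Iic (φ x a) := by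
    ext b
    constructor
    · exact fun hb => ⟨hb.1, hb.2 a ha⟩
    · exact fun hb => ⟨hb.1, fun d hd => le_trans hb.2 (h d hd)⟩
  rw [this]
  exact hφ.isCompact_inter_preimage_Iic hc _

/-- A minimizer lies in `F` exactly when the minimum over `K x ∩ F` equals that over `K x`.
Comparing sublevel sets at rational levels makes this a countable condition; compactness ensures
that the minimum over `K x ∩ F` is attained. -/
lemma measurableSet_argminOn_inter [T2Space A] {K : X → Set A} {φ : X → A → ℝ}
    (hc : ∀ x, IsCompact (K x)) (hne : ∀ x, (K x).Nonempty)
    (hφ : ∀ x, LowerSemicontinuousOn (φ x) (K x))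
    (hm : ∀ F, IsClosed F → ∀ r : ℝ, MeasurableSet {x | ∃ a ∈ K x ∩ F, φ x a ≤ r})
    {F : Set A} (hF : IsClosed F) : MeasurableSet {x | (argminOn K φ x ∩ F).Nonempty} := by
  have : {x | (argminOn K φ x ∩ F).Nonempty} =
      ⋂ r : ℚ, {x | ∃ a ∈ K x ∩ Set.univ, φ x a ≤ (r : ℝ)}ᶜ ∪
        {x | ∃ a ∈ K x ∩ F, φ x a ≤ (r : ℝ)} := by
    ext x
    simp only [Set.mem_iInter, Set.mem_union, Set.mem_compl_iff, Set.mem_ofPred_eq,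
      Set.inter_univ]
    constructor
    · rintro ⟨a, ha, haF⟩ r
      by_cases h : ∃ b ∈ K x, φ x b ≤ r
      · obtain ⟨b, hb, hbr⟩ := h
        exact Or.inr ⟨a, ⟨ha.1, haF⟩, (ha.2 b hb).trans hbr⟩
      · exact Or.inl h
    · intro h
      have h' : ∀ b ∈ K x, ∀ r : ℚ, φ x b ≤ r → ∃ a ∈ K x ∩ F, φ x a ≤ r := fun b hb r hr =>
        (h r).resolve_left (not_not.2 ⟨b, hb, hr⟩)
      have hne' : (K x ∩ F).Nonempty := by
        obtain ⟨b, hb⟩ := hne x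
        obtain ⟨r, hr⟩ := exists_rat_gt (φ x b)
        obtain ⟨a, ha, -⟩ := h' b hb r hr.le
        exact ⟨a, ha⟩
      obtain ⟨a, ha, hmin⟩ := ((hφ x).mono Set.inter_subset_left).exists_isMinOn hne'
        ((hc x).inter_right hF)
      refine ⟨a, ⟨ha.1, fun b hb => ?_⟩, ha.2⟩
      by_contra! hlt
      obtain ⟨r, hr1, hr2⟩ := exists_rat_btwn hlt
      obtain ⟨a', ha', hr'⟩ := h' b hb r hr1.le
      exact absurd (hmin ha') (not_le.2 (hr'.trans_lt hr2))
  rw [this]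
  exact MeasurableSet.iInter fun r => (hm _ isClosed_univ r).compl.union (hm _ hF r)

variable [TopologicalSpace.MetrizableSpace A] [SecondCountableTopology A] [MeasurableSpace A]
  [BorelSpace A]

/-- A weakly measurable correspondence with nonempty compact values has a measurable selector. -/
theorem exists_measurable_selector {K : X → Set A} (hne : ∀ x, (K x).Nonempty)
    (hc : ∀ x, IsCompact (K x))
    (hm : ∀ F, IsClosed F → MeasurableSet {x | (K x ∩ F).Nonempty}) :
    ∃ s : X → A, Measurable s ∧ ∀ x, s x ∈ K x := by
  let _ := TopologicalSpace.metrizableSpaceMetric A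
  rcases isEmpty_or_nonempty X with hX | ⟨⟨x₀⟩⟩
  · exact ⟨fun x => hX.elim x, measurable_of_empty _, fun x => hX.elim x⟩
  have : Nonempty A := ⟨(hne x₀).some⟩
  let e : ℕ → A := TopologicalSpace.denseSeq A
  let S : ℕ → X → Set A := fun n => Nat.rec K (fun n K' => argminOn K' fun _ a => dist a (e n)) n
  have hlsc : ∀ n (s : Set A), LowerSemicontinuousOn (fun a => dist a (e n)) s := fun n s =>
    (continuous_id.dist continuous_const).lowerSemicontinuous.lowerSemicontinuousOn _
  have hS : ∀ n, (∀ x, (S n x).Nonempty) ∧ (∀ x, IsCompact (S n x)) ∧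
      ∀ F, IsClosed F → MeasurableSet {x | (S n x ∩ F).Nonempty} := by
    intro n
    induction n with
    | zero => exact ⟨hne, hc, hm⟩
    | succ n ih =>
      obtain ⟨h1, h2, h3⟩ := ih
      refine ⟨fun x => argminOn_nonempty (h1 x) (h2 x) (hlsc n _),
        fun x => isCompact_argminOn (h1 x) (h2 x) (hlsc n _), fun F hF =>
        measurableSet_argminOn_inter h2 h1 (fun x => hlsc n _) (fun F' hF' r => ?_) hF⟩
      have hcl : IsClosed (F' ∩ {a | dist a (e n) ≤ r}) :=
        hF'.inter (isClosed_le (continuous_id.dist continuous_const) continuous_const)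
      convert h3 _ hcl using 1
      ext x
      constructor
      · rintro ⟨a, ⟨h, h'⟩, h''⟩
        exact ⟨a, h, h', h''⟩
      · rintro ⟨a, h, h', h''⟩
        exact ⟨a, ⟨h, h'⟩, h''⟩
  have hanti : ∀ n x, S (n + 1) x ⊆ S n x := fun n x a ha => ha.1
  have hinter : ∀ F, IsClosed F → ∀ x, (∀ n, (S n x ∩ F).Nonempty) →
      (⋂ n, S n x ∩ F).Nonempty := fun F hF x h =>
    IsCompact.nonempty_iInter_of_sequence_nonempty_isCompact_isClosed _
      (fun n => Set.inter_subset_inter_left _ (hanti n x)) h (((hS 0).2.1 x).inter_right hF)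
      fun n => ((hS n).2.1 x).isClosed.inter hF
  have hsel : ∀ x, ∃ a, ∀ n, a ∈ S n x := by
    intro x
    obtain ⟨a, ha⟩ := hinter Set.univ isClosed_univ x
      (fun n => by simpa using (hS n).1 x)
    exact ⟨a, fun n => (Set.mem_iInter.1 ha n).1⟩
  choose s hs using hsel
  have huniq : ∀ x a, (∀ n, a ∈ S n x) → a = s x := by
    intro x a ha
    have hd : ∀ n, dist a (e n) = dist (s x) (e n) := fun n =>
      le_antisymm ((ha (n + 1)).2 _ (hs x n)) ((hs x (n + 1)).2 _ (ha n))
    have hcont : (fun b => dist a b) = fun b => dist (s x) b :=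
      Continuous.ext_on (TopologicalSpace.denseRange_denseSeq A)
        (continuous_const.dist continuous_id) (continuous_const.dist continuous_id)
        (by rintro _ ⟨n, rfl⟩; exact hd n)
    have := congrFun hcont (s x)
    simpa using this
  refine ⟨s, measurable_of_isClosed fun F hF => ?_, fun x => hs x 0⟩
  have : s ⁻¹' F = ⋂ n, {x | (S n x ∩ F).Nonempty} := by
    ext x
    simp only [Set.mem_preimage, Set.mem_iInter, Set.mem_ofPred_eq]
    constructor
    · exact fun h n => ⟨s x, hs x n, h⟩
    · intro h
      obtain ⟨a, ha⟩ := hinter F hF x h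
      rw [← huniq x a fun n => (Set.mem_iInter.1 ha n).1]
      exact (Set.mem_iInter.1 ha 0).2
  rw [this]
  exact MeasurableSet.iInter fun n => (hS n).2.2 F hF

omit [MeasurableSpace X] [SecondCountableTopology A] [MeasurableSpace A] [BorelSpace A] in
-- Along a sequence in this set the witnesses have a cluster point over the limit. A subsequence
-- converges to it, and lower semicontinuity preserves the bound.
lemma isClosed_setOf_exists_le [TopologicalSpace X] [FirstCountableTopology X]
    {S : Set (X × A)}
    (husc : ∀ (x : X) (u : ℕ → X) (a : ℕ → A), Tendsto u atTop (𝓝 x) → (∀ k, (u k, a k) ∈ S) →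
      ∃ b, (x, b) ∈ S ∧ MapClusterPt b atTop a)
    {φ : X → A → ℝ} (hφ : LowerSemicontinuousOn (fun w : X × A => φ w.1 w.2) S)
    {F : Set A} (hF : IsClosed F) (r : ℝ) :
    IsClosed {x | ∃ a ∈ {a | (x, a) ∈ S} ∩ F, φ x a ≤ r} := by
  refine IsSeqClosed.isClosed fun u x hu hux => ?_
  choose a ha har using hu
  obtain ⟨b, hb, hcl⟩ := husc x u a hux fun k => (ha k).1
  obtain ⟨ψ, hψ, hlim⟩ := hcl.tendsto_subseq
  refine ⟨b, ⟨hb, hF.mem_of_tendsto hlim (Eventually.of_forall fun k => (ha _).2)⟩, ?_⟩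
  by_contra! hlt
  have hT : Tendsto (fun k => (u (ψ k), a (ψ k))) atTop (𝓝[S] (x, b)) :=
    tendsto_nhdsWithin_iff.2 ⟨(hux.comp hψ.tendsto_atTop).prodMk_nhds hlim,
      Eventually.of_forall fun k => (ha _).1⟩
  obtain ⟨k, hk⟩ := (hT.eventually (hφ (x, b) hb r hlt)).exists
  exact absurd (har (ψ k)) (not_le.2 hk)

/-- Measurable selection of minimizers of a lower semicontinuous function over an upper
semicontinuous compact-valued correspondence. -/
theorem exists_measurable_argmin [TopologicalSpace X] [FirstCountableTopology X]
    [OpensMeasurableSpace X] {S : Set (X × A)} (hne : ∀ x, ∃ a, (x, a) ∈ S)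
    (hc : ∀ x, IsCompact {a | (x, a) ∈ S})
    (husc : ∀ (x : X) (u : ℕ → X) (a : ℕ → A), Tendsto u atTop (𝓝 x) → (∀ k, (u k, a k) ∈ S) →
      ∃ b, (x, b) ∈ S ∧ MapClusterPt b atTop a)
    {φ : X → A → ℝ} (hφ : LowerSemicontinuousOn (fun w : X × A => φ w.1 w.2) S) :
    ∃ s : X → A, Measurable s ∧ (∀ x, (x, s x) ∈ S) ∧
      (∀ x a, (x, a) ∈ S → φ x (s x) ≤ φ x a) ∧ LowerSemicontinuous fun x => φ x (s x) := by
  let K : X → Set A := fun x => {a | (x, a) ∈ S}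
  have hlsc : ∀ x, LowerSemicontinuousOn (φ x) (K x) := fun x =>
    LowerSemicontinuousOn.comp (f := fun w : X × A => φ w.1 w.2) (g := fun a => (x, a)) hφ
      (by fun_prop) fun a ha => ha
  have hcl := fun F hF r => isClosed_setOf_exists_le husc hφ (F := F) hF r
  obtain ⟨s, hs, hmem⟩ := exists_measurable_selector (K := argminOn K φ)
    (fun x => argminOn_nonempty (hne x) (hc x) (hlsc x))
    (fun x => isCompact_argminOn (hne x) (hc x) (hlsc x))
    (fun F hF => measurableSet_argminOn_inter hc hne hlsc
      (fun F hF r => (hcl F hF r).measurableSet) hF)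
  refine ⟨s, hs, fun x => (hmem x).1, fun x a ha => (hmem x).2 a ha, ?_⟩
  refine lowerSemicontinuous_iff_isClosed_preimage.2 fun r => ?_
  convert hcl Set.univ isClosed_univ r using 1
  ext x
  constructor
  · exact fun h => ⟨s x, ⟨(hmem x).1, trivial⟩, h⟩
  · rintro ⟨a, ⟨ha, -⟩, h⟩
    exact ((hmem x).2 a ha).trans h

/-- Measurable selection of maximizers over a compact space. -/
theorem exists_measurable_argmax [Nonempty A] [CompactSpace A] [TopologicalSpace X]
    [OpensMeasurableSpace X] {φ : X → A → ℝ}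
    (h1 : ∀ x, UpperSemicontinuous (φ x)) (h2 : ∀ a, LowerSemicontinuous fun x => φ x a) :
    ∃ s : X → A, Measurable s ∧ ∀ x a, φ x a ≤ φ x (s x) := by
  let K : X → Set A := fun _ => Set.univ
  have hc : ∀ x, IsCompact (K x) := fun _ => isCompact_univ
  have hne : ∀ x, (K x).Nonempty := fun _ => Set.univ_nonempty
  have hlsc : ∀ x, LowerSemicontinuousOn (fun a => -φ x a) (K x) := fun x =>
    (continuous_neg.comp_upperSemicontinuous_antitone (h1 x)
      fun _ _ h => neg_le_neg h).lowerSemicontinuousOn _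
  have hm : ∀ F, IsClosed F → ∀ r : ℝ, MeasurableSet {x | ∃ a ∈ K x ∩ F, -φ x a ≤ r} := by
    intro F hF r
    rcases F.eq_empty_or_nonempty with rfl | hFne
    · simp
    have hcl : ∀ t : ℝ, MeasurableSet {x | ∀ a ∈ F, φ x a ≤ t} := by
      intro t
      have : {x | ∀ a ∈ F, φ x a ≤ t} = ⋂ a ∈ F, (fun x => φ x a) ⁻¹' Set.Iic t := by
        ext x; simp
      rw [this]
      exact (isClosed_biInter fun a _ => (h2 a).isClosed_preimage t).measurableSet
    -- No joint semicontinuity is available here. The supremum over `F` is attained by compactness,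
    -- and it is at least `-r` unless some rational `t < -r` bounds `φ x` on `F`. Each such
    -- exceptional set is closed in `x`, being an intersection of sublevel sets.
    have : {x | ∃ a ∈ K x ∩ F, -φ x a ≤ r} =
        (⋃ t : {t : ℚ // (t : ℝ) < -r}, {x | ∀ a ∈ F, φ x a ≤ (t : ℝ)})ᶜ := by
      ext x
      simp only [Set.mem_ofPred_eq, Set.mem_compl_iff, Set.mem_iUnion, not_exists]
      constructor
      · rintro ⟨a, ha, har⟩ t ht
        have := ht a ha.2
        have := t.2
        linarith
      · intro h
        obtain ⟨a, ha, hmin⟩ := ((hlsc x).mono (Set.subset_univ F)).exists_isMinOn hFne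
          hF.isCompact
        refine ⟨a, ⟨trivial, ha⟩, ?_⟩
        by_contra! hlt
        obtain ⟨t, ht1, ht2⟩ := exists_rat_btwn (show φ x a < -r by linarith)
        refine h ⟨t, ht2⟩ fun b hb => ?_
        have : -φ x a ≤ -φ x b := hmin hb
        linarith
    rw [this]
    refine (MeasurableSet.iUnion fun t => ?_).compl
    exact hcl _
  obtain ⟨s, hs, hmem⟩ := exists_measurable_selector (K := argminOn K fun x a => -φ x a)
    (fun x => argminOn_nonempty (hne x) (hc x) (hlsc x))
    (fun x => isCompact_argminOn (hne x) (hc x) (hlsc x))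
    (fun F hF => measurableSet_argminOn_inter hc hne hlsc hm hF)
  exact ⟨s, hs, fun x a => neg_le_neg_iff.1 ((hmem x).2 a trivial)⟩

end Selection

/-! ### A minimax theorem by separation. -/

section Minimax

variable {V Y : Type*} [AddCommGroup V] [Module ℝ V]

/-- Otherwise the open orthant above `(c, …, c)` in `I → ℝ` misses the convex set of vectors
dominated by some `(H v y)_v`. A separating functional has nonpositive coefficients; normalizing
their negatives to weights gives a convex combination of the points of `I` at which every `y` yields
at most `c`, contradicting `h`. -/
lemma exists_forall_finset_le_of_convex_concave [Nonempty Y] {S : Set V}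
    {H : V → Y → ℝ} (hcvx : ∀ y, ConvexOn ℝ S fun v => H v y)
    (hconc : ∀ y₁ y₂ : Y, ∀ s t : ℝ, 0 ≤ s → 0 ≤ t → s + t = 1 →
      ∃ y, ∀ v ∈ S, s * H v y₁ + t * H v y₂ ≤ H v y)
    {c : ℝ} (h : ∀ v ∈ S, ∃ y, c < H v y) (I : Finset S) : ∃ y, ∀ v ∈ I, c ≤ H v y := by
  classical
  by_contra! hno
  let O : Set (I → ℝ) := Set.univ.pi fun _ => Set.Ioi c
  let U : Set (I → ℝ) := {u | ∃ y, ∀ i : I, u i ≤ H i y}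
  have hO : Convex ℝ O := convex_pi fun _ _ => convex_Ioi c
  have hOo : IsOpen O := isOpen_set_pi Set.finite_univ fun _ _ => isOpen_Ioi
  have hU : Convex ℝ U := by
    rintro u₁ ⟨y₁, h₁⟩ u₂ ⟨y₂, h₂⟩ s t hs ht hst
    obtain ⟨y, hy⟩ := hconc y₁ y₂ s t hs ht hst
    refine ⟨y, fun i => le_trans ?_ (hy i i.1.2)⟩
    simp only [Pi.add_apply, Pi.smul_apply, smul_eq_mul]
    gcongr
    · exact h₁ i
    · exact h₂ i
  have hdisj : Disjoint O U := by
    refine Set.disjoint_left.2 ?_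
    rintro u hu ⟨y, hy⟩
    obtain ⟨v, hv, hlt⟩ := hno y
    have h1 := hu ⟨v, hv⟩ trivial
    have h2 := hy ⟨v, hv⟩
    simp only [Set.mem_Ioi] at h1
    linarith
  obtain ⟨f, w, hfO, hfU⟩ := geometric_hahn_banach_open hO hOo hU hdisj
  let l : I → ℝ := fun i => -f (Pi.single i 1)
  have hf : ∀ u : I → ℝ, f u = -∑ i, l i * u i := by
    intro u
    conv_lhs => rw [← Finset.univ_sum_single u]
    rw [map_sum, ← Finset.sum_neg_distrib]
    refine Finset.sum_congr rfl fun i _ => ?_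
    have : (Pi.single i (u i) : I → ℝ) = u i • Pi.single i 1 := by
      rw [← Pi.single_smul, smul_eq_mul, mul_one]
    rw [this, map_smul, smul_eq_mul]
    simp only [l]
    ring
  have hl : ∀ i, 0 ≤ l i := by
    intro i
    by_contra! hneg
    -- If `l i < 0`, moving this far in direction `i` stays inside `O` but raises `f` to at least
    -- `|w|`, against `f < w` on `O`.
    let s : ℝ := (|∑ j, l j * (c + 1)| + |w|) / (-l i)
    have hs : 0 ≤ s := div_nonneg (by positivity) (by linarith)
    have hmem : (fun j => c + 1) + s • Pi.single i 1 ∈ O := by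
      intro j _
      by_cases hij : j = i
      · subst hij
        simp only [Pi.add_apply, Pi.smul_apply, Pi.single_eq_same, smul_eq_mul, Set.mem_Ioi]
        linarith
      · simp [hij]
    have h1 := hfO _ hmem
    rw [hf] at h1
    have h2 : ∑ j, l j * ((fun j => c + 1) + s • Pi.single i 1 : I → ℝ) j =
        ∑ j, l j * (c + 1) + s * l i := by
      simp only [Pi.add_apply, Pi.smul_apply, smul_eq_mul, mul_add, Finset.sum_add_distrib]
      congr 1
      rw [Finset.sum_eq_single i]
      · rw [Pi.single_eq_same]; ring
      · intro j _ hj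
        rw [Pi.single_eq_of_ne hj]; ring
      · simp
    rw [h2] at h1
    have h3 : s * l i = -(|∑ j, l j * (c + 1)| + |w|) := by
      rw [div_mul_eq_mul_div, div_neg, mul_div_assoc, div_self hneg.ne, mul_one]
    rw [h3] at h1
    have h4 := le_abs_self (∑ j, l j * (c + 1))
    have h5 := le_abs_self w
    linarith
  obtain ⟨y₀⟩ := ‹Nonempty Y›
  have hΛ : 0 < ∑ i, l i := by
    refine lt_of_le_of_ne (Finset.sum_nonneg fun i _ => hl i) fun h0 => ?_
    have hz : ∀ i, l i = 0 := fun i =>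
      (Finset.sum_eq_zero_iff_of_nonneg fun i _ => hl i).1 h0.symm i (Finset.mem_univ i)
    have h1 := hfO (fun _ => c + 1) fun i _ => by simp
    have h2 := hfU (fun i => H i y₀) ⟨y₀, fun i => le_rfl⟩
    rw [hf] at h1 h2
    simp only [hz, zero_mul, Finset.sum_const_zero, neg_zero] at h1 h2
    linarith
  -- Let points of `O` approach its corner `(c, …, c)`.
  have hcw : -w ≤ c * ∑ i, l i := by
    refine le_of_forall_pos_lt_add fun ε hε => ?_
    have h1 := hfO (fun _ => c + ε / ∑ i, l i) fun i _ => by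
      simp only [Set.mem_Ioi]
      linarith [div_pos hε hΛ]
    rw [hf, ← Finset.sum_mul, mul_add, mul_div_cancel₀ _ hΛ.ne'] at h1
    linarith
  let Λ := ∑ i, l i
  have hsum : ∑ i, l i / Λ = 1 := by rw [← Finset.sum_div]; exact div_self hΛ.ne'
  have hnn : ∀ i ∈ Finset.univ, 0 ≤ l i / Λ := fun i _ => div_nonneg (hl i) hΛ.le
  obtain ⟨y, hy⟩ := h (∑ i : I, (l i / Λ) • ((i : S) : V))
    ((hcvx y₀).1.sum_mem hnn hsum fun i _ => i.1.2)
  have h1 := (hcvx y).map_sum_le hnn hsum fun i _ => i.1.2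
  have h2 := hfU (fun i => H i y) ⟨y, fun i => le_rfl⟩
  rw [hf] at h2
  have h3 : ∑ i : I, (l i / Λ) • H ((i : S) : V) y = (∑ i : I, l i * H ((i : S) : V) y) / Λ := by
    rw [Finset.sum_div]
    exact Finset.sum_congr rfl fun i _ => by rw [smul_eq_mul]; ring
  rw [h3] at h1
  have h4 : (∑ i : I, l i * H ((i : S) : V) y) / Λ ≤ c := (div_le_iff₀ hΛ).2 (by linarith)
  linarith

/-- A minimax inequality: one side ranges over a convex set without topology, the other one over a
compact space without linear structure. -/
theorem exists_forall_le_of_convex_concave [TopologicalSpace Y] [CompactSpace Y] [Nonempty Y]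
    {S : Set V} {H : V → Y → ℝ} (hcvx : ∀ y, ConvexOn ℝ S fun v => H v y)
    (hcont : ∀ v ∈ S, UpperSemicontinuous (H v))
    (hconc : ∀ y₁ y₂ : Y, ∀ s t : ℝ, 0 ≤ s → 0 ≤ t → s + t = 1 →
      ∃ y, ∀ v ∈ S, s * H v y₁ + t * H v y₂ ≤ H v y)
    {c : ℝ} (h : ∀ v ∈ S, ∃ y, c < H v y) : ∃ y, ∀ v ∈ S, c ≤ H v y := by
  have := isCompact_univ (X := Y).inter_iInter_nonempty (fun v : S => {y | c ≤ H v y})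
    (fun v => (hcont v v.2).isClosed_preimage c) fun I => by
      obtain ⟨y, hy⟩ := exists_forall_finset_le_of_convex_concave hcvx hconc h I
      exact ⟨y, trivial, Set.mem_iInter₂.2 hy⟩
  obtain ⟨y, -, hy⟩ := this
  exact ⟨y, fun v hv => Set.mem_iInter.1 hy ⟨v, hv⟩⟩

end Minimax

/-! ### Riesz representation of positive functionals on `L^p`. -/

section Representation

open scoped NNReal

variable {Z : Type*} [MeasurableSpace Z] {P : Measure Z} [IsProbabilityMeasure P] {p q : ℝ≥0∞}

/-- The set function of a positive functional on `L^p`, `p < ∞`, is a measure. -/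
lemma exists_measure_of_positive_functional [Fact (1 ≤ p)] (hp : p ≠ ∞)
    (φ : Lp ℝ p P →L[ℝ] ℝ) (hφ : ∀ g, 0 ≤ g → 0 ≤ φ g) :
    ∃ ν : Measure Z, ∀ B (hB : MeasurableSet B),
      ν B = ENNReal.ofReal (φ (indicatorConstLp p hB (measure_ne_top P B) (1 : ℝ))) := by
  have hnn : ∀ B (hB : MeasurableSet B),
      0 ≤ φ (indicatorConstLp p hB (measure_ne_top P B) (1 : ℝ)) := fun B hB => by
    refine hφ _ ((Lp.coeFn_nonneg _).1 ?_)
    filter_upwards [indicatorConstLp_coeFn (p := p) (hs := hB)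
      (hμs := measure_ne_top P B) (c := (1 : ℝ))] with z hz
    rw [hz]
    exact Set.indicator_nonneg (fun _ _ => zero_le_one) z
  refine ⟨Measure.ofMeasurable (fun B hB =>
    ENNReal.ofReal (φ (indicatorConstLp p hB (measure_ne_top P B) (1 : ℝ)))) ?_ ?_,
    fun B hB => Measure.ofMeasurable_apply B hB⟩
  · simp [indicatorConstLp_empty]
  · intro B hB hd
    let S : ℕ → Set Z := fun m => ⋃ i ∈ Finset.range m, B i
    have hS : ∀ m, MeasurableSet (S m) := fun m =>
      Finset.measurableSet_biUnion _ fun i _ => hB i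
    have hsum : ∀ m, ∑ i ∈ Finset.range m,
        ENNReal.ofReal (φ (indicatorConstLp p (hB i) (measure_ne_top P (B i)) (1 : ℝ))) =
        ENNReal.ofReal (φ (indicatorConstLp p (hS m) (measure_ne_top P (S m)) (1 : ℝ))) := by
      intro m
      induction m with
      | zero => simp [S, indicatorConstLp_empty]
      | succ m ih =>
        have hdis : S m ∩ B m = ∅ := by
          refine Set.disjoint_iff_inter_eq_empty.1 ?_
          simp only [S, Set.disjoint_iUnion_left]
          exact fun i hi => hd (Finset.mem_range.1 hi).ne
        have hU : S (m + 1) = S m ∪ B m := by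
          simp only [S, Finset.range_add_one, Finset.set_biUnion_insert, Set.union_comm]
        have h1 := indicatorConstLp_disjoint_union (p := p) (hS m) (hB m)
          (measure_ne_top P _) (measure_ne_top P _) (Set.disjoint_iff_inter_eq_empty.2 hdis)
          (1 : ℝ)
        have h2 : indicatorConstLp p (hS (m + 1)) (measure_ne_top P (S (m + 1))) (1 : ℝ) =
            indicatorConstLp p ((hS m).union (hB m)) (measure_ne_top P _) (1 : ℝ) := by
          congr 1
        rw [Finset.sum_range_succ, ih, h2, h1, map_add,
          ENNReal.ofReal_add (hnn _ _) (hnn _ _)]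
    -- Countable additivity: the measure of the remaining tail tends to zero, so the indicators
    -- converge in `L^p` because `p < ∞`.
    have hlim : Tendsto (fun m => indicatorConstLp p (hS m) (measure_ne_top P (S m)) (1 : ℝ))
        atTop (𝓝 (indicatorConstLp p (MeasurableSet.iUnion hB) (measure_ne_top P _) (1 : ℝ))) := by
      refine tendsto_indicatorConstLp_set hp ?_
      have hsub : ∀ m, S m ⊆ ⋃ i, B i := fun m =>
        Set.iUnion₂_subset fun i _ => Set.subset_iUnion B i
      have hmono : Monotone S := fun a b hab =>
        Set.biUnion_mono (fun i hi => Finset.mem_range.2 ((Finset.mem_range.1 hi).trans_le hab))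
          fun _ _ => le_rfl
      have hSU : ⋃ m, S m = ⋃ i, B i := by
        refine Set.Subset.antisymm (Set.iUnion_subset hsub) (Set.iUnion_subset fun i => ?_)
        exact Set.subset_iUnion_of_subset (i + 1)
          (Set.subset_biUnion_of_mem (u := B) (Finset.self_mem_range_succ i))
      have h1 : Tendsto (fun m => P ((⋃ i, B i) \ S m)) atTop (𝓝 (P (⋂ m, (⋃ i, B i) \ S m))) :=
        tendsto_measure_iInter_atTop
          (fun m => ((MeasurableSet.iUnion hB).diff (hS m)).nullMeasurableSet)
          (fun a b hab => Set.sdiff_subset_sdiff_right (hmono hab)) ⟨0, measure_ne_top P _⟩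
      rw [← Set.sdiff_iUnion, hSU, Set.sdiff_self, measure_empty] at h1
      refine h1.congr fun m => ?_
      rw [symmDiff_comm, Set.symmDiff_def]
      simp [Set.sdiff_eq_empty.2 (hsub m)]
    refine tendsto_nhds_unique ?_ (ENNReal.tendsto_nat_tsum _)
    simp only [hsum]
    exact (ENNReal.continuous_ofReal.comp φ.continuous).continuousAt.tendsto.comp hlim

lemma lintegral_simpleFunc_eq_functional [Fact (1 ≤ p)]
    (φ : Lp ℝ p P →L[ℝ] ℝ) (hφ : ∀ g, 0 ≤ g → 0 ≤ φ g) {ν : Measure Z}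
    (hν : ∀ B (hB : MeasurableSet B),
      ν B = ENNReal.ofReal (φ (indicatorConstLp p hB (measure_ne_top P B) (1 : ℝ))))
    (G : SimpleFunc Z ℝ≥0) (hG : MemLp (fun z => (G z : ℝ)) p P) :
    ∫⁻ z, G z ∂ν = ENNReal.ofReal (φ hG.toLp) := by
  induction G using SimpleFunc.induction with
  | @const c B hB =>
    have h1 : hG.toLp = (c : ℝ) • indicatorConstLp p hB (measure_ne_top P B) (1 : ℝ) := by
      refine Lp.ext ?_
      filter_upwards [hG.coeFn_toLp, Lp.coeFn_smul (c : ℝ)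
        (indicatorConstLp p hB (measure_ne_top P B) (1 : ℝ)),
        indicatorConstLp_coeFn (p := p) (hs := hB)
          (hμs := measure_ne_top P B) (c := (1 : ℝ))] with z h1 h2 h3
      rw [h1, h2, Pi.smul_apply, h3]
      by_cases hz : z ∈ B <;> simp [hz, SimpleFunc.piecewise_apply]
    have h2 : ∀ z, (((SimpleFunc.piecewise B hB (SimpleFunc.const Z c)
        (SimpleFunc.const Z 0)) z : ℝ≥0) : ℝ≥0∞) = B.indicator (fun _ => (c : ℝ≥0∞)) z := by
      intro z
      by_cases hz : z ∈ B <;> simp [hz, SimpleFunc.piecewise_apply]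
    simp only [h2]
    rw [lintegral_indicator_const hB, hν B hB, h1, map_smul, smul_eq_mul,
      ENNReal.ofReal_mul (NNReal.coe_nonneg c), ENNReal.ofReal_coe_nnreal]
  | @add G₁ G₂ hd h₁ h₂ =>
    have hG₁ : MemLp (fun z => (G₁ z : ℝ)) p P :=
      (G₁.map ((↑) : ℝ≥0 → ℝ)).memLp_of_isFiniteMeasure p P
    have hG₂ : MemLp (fun z => (G₂ z : ℝ)) p P :=
      (G₂.map ((↑) : ℝ≥0 → ℝ)).memLp_of_isFiniteMeasure p P
    have hs : hG.toLp = hG₁.toLp + hG₂.toLp := by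
      rw [← MemLp.toLp_add]
      exact MemLp.toLp_congr _ _ (Eventually.of_forall fun z => by simp)
    have hnn : ∀ {G : SimpleFunc Z ℝ≥0} (h : MemLp (fun z => (G z : ℝ)) p P), 0 ≤ φ h.toLp := by
      intro G h
      refine hφ _ ((Lp.coeFn_nonneg _).1 ?_)
      filter_upwards [h.coeFn_toLp] with z hz
      rw [hz]
      exact (G z).2
    rw [hs, map_add, ENNReal.ofReal_add (hnn hG₁) (hnn hG₂), ← h₁ hG₁, ← h₂ hG₂,
      ← lintegral_add_left (by exact G₁.measurable.coe_nnreal_ennreal)]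
    simp

/-- The absorption step of the converse Hölder inequality: `x ^ r⁻¹` can be cancelled because `x` is
finite. -/
lemma rpow_inv_le_of_le_mul_rpow_inv {r s : ℝ} (hr : 0 < r) (hs : 0 < s)
    (hrs : r⁻¹ + s⁻¹ = 1) {K x : ℝ≥0∞} (hx : x ≠ ∞) (h : x ≤ K * x ^ r⁻¹) : x ≤ K ^ s := by
  rcases eq_or_ne x 0 with rfl | hx0
  · exact zero_le
  have h1 : x = x ^ s⁻¹ * x ^ r⁻¹ := by
    rw [← ENNReal.rpow_add _ _ hx0 hx, add_comm, hrs, ENNReal.rpow_one]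
  have h2 : x ^ s⁻¹ ≤ K := by
    have h0 : x ^ r⁻¹ ≠ 0 := by simp [hx0, hx]
    have ht : x ^ r⁻¹ ≠ ∞ := ENNReal.rpow_ne_top_of_nonneg (by positivity) hx
    exact (ENNReal.mul_le_mul_iff_left h0 ht).1 (h1.symm.le.trans h)
  exact (ENNReal.rpow_inv_le_iff hs).1 h2

/-- Converse Hölder inequality. For simple `g ≤ f` test with `g ^ (s - 1)`: since `(s - 1) r = s`,
this gives `∫ g ^ s ≤ C (∫ g ^ s) ^ r⁻¹`, where the integral is finite and can be absorbed. Monotone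
convergence passes to `f`. -/
lemma lintegral_rpow_le_of_forall_simpleFunc {f : Z → ℝ≥0∞} (hf : Measurable f) {r s : ℝ}
    (hrs : r.HolderConjugate s) {C : ℝ≥0∞}
    (hC : ∀ G : SimpleFunc Z ℝ≥0,
      ∫⁻ z, f z * G z ∂P ≤ C * (∫⁻ z, (G z : ℝ≥0∞) ^ r ∂P) ^ r⁻¹) :
    ∫⁻ z, f z ^ s ∂P ≤ C ^ s := by
  have hs0 : 0 < s := hrs.symm.pos
  have hs1 : 0 < s - 1 := hrs.symm.sub_one_pos
  let g : ℕ → SimpleFunc Z ℝ≥0 := fun m => (SimpleFunc.eapprox f m).map ENNReal.toNNReal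
  have hg : ∀ m z, (g m z : ℝ≥0∞) = SimpleFunc.eapprox f m z := fun m z =>
    ENNReal.coe_toNNReal (SimpleFunc.eapprox_lt_top f m z).ne
  have hgf : ∀ m z, (g m z : ℝ≥0∞) ≤ f z := fun m z => by
    rw [hg, ← SimpleFunc.iSup_eapprox_apply hf z]
    exact le_iSup (fun n => (SimpleFunc.eapprox f n : Z → ℝ≥0∞) z) m
  have hI : ∀ m, ∫⁻ z, (g m z : ℝ≥0∞) ^ s ∂P ≤ C ^ s := by
    intro m
    refine rpow_inv_le_of_le_mul_rpow_inv hrs.pos hs0 hrs.inv_add_inv_eq_one ?_ ?_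
    · obtain ⟨B, hB⟩ := (g m).finite_range.bddAbove
      refine ne_of_lt (lt_of_le_of_lt (lintegral_mono (g := fun _ => (B : ℝ≥0∞) ^ s)
        fun z => ?_) ?_)
      · have : g m z ≤ B := hB ⟨z, rfl⟩
        exact ENNReal.rpow_le_rpow (ENNReal.coe_le_coe.2 this) hs0.le
      · rw [lintegral_const, measure_univ, mul_one]
        exact ENNReal.rpow_lt_top_of_nonneg hs0.le ENNReal.coe_ne_top
    · have hG : ∀ z, (((g m).map (· ^ (s - 1)) z : ℝ≥0) : ℝ≥0∞) = (g m z : ℝ≥0∞) ^ (s - 1) :=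
        fun z => by
          rw [SimpleFunc.map_apply, ENNReal.coe_rpow_of_nonneg _ hs1.le]
      have h1 := hC ((g m).map (· ^ (s - 1)))
      simp only [hG, ← ENNReal.rpow_mul, hrs.symm.sub_one_mul_conj] at h1
      refine le_trans (lintegral_mono fun z => ?_) h1
      calc (g m z : ℝ≥0∞) ^ s = (g m z : ℝ≥0∞) ^ (1 + (s - 1)) := by congr 1; ring
        _ = (g m z : ℝ≥0∞) * (g m z : ℝ≥0∞) ^ (s - 1) := by
          rw [ENNReal.rpow_add_of_nonneg _ _ zero_le_one hs1.le, ENNReal.rpow_one]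
        _ ≤ f z * (g m z : ℝ≥0∞) ^ (s - 1) := by gcongr; exact hgf m z
  have hsup : ∀ z, f z ^ s = ⨆ m, (g m z : ℝ≥0∞) ^ s := by
    intro z
    rw [← SimpleFunc.iSup_eapprox_apply hf z]
    simp only [hg]
    exact (ENNReal.orderIsoRpow s hs0).map_iSup _
  simp only [hsup]
  rw [lintegral_iSup (fun m => by fun_prop)]
  · exact iSup_le hI
  · intro a b hab z
    simp only [hg]
    exact ENNReal.rpow_le_rpow (SimpleFunc.monotone_eapprox f hab z) hs0.le

/-- Riesz representation of positive functionals on `L^p`, `p < ∞`. -/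
theorem exists_Lp_eq_positive_functional [Fact (1 ≤ p)] [Fact (1 ≤ q)]
    [ENNReal.HolderConjugate p q]
    (hp : p ≠ ∞) (φ : Lp ℝ p P →L[ℝ] ℝ) (hφ : ∀ g, 0 ≤ g → 0 ≤ φ g) :
    ∃ f : Lp ℝ q P, ∀ g : Lp ℝ p P, ∫ z, f z * g z ∂P = φ g := by
  obtain ⟨ν, hν⟩ := exists_measure_of_positive_functional hp φ hφ
  have hnn : ∀ B (hB : MeasurableSet B),
      0 ≤ φ (indicatorConstLp p hB (measure_ne_top P B) (1 : ℝ)) := fun B hB => by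
    refine hφ _ ((Lp.coeFn_nonneg _).1 ?_)
    filter_upwards [indicatorConstLp_coeFn (p := p) (hs := hB)
      (hμs := measure_ne_top P B) (c := (1 : ℝ))] with z hz
    rw [hz]
    exact Set.indicator_nonneg (fun _ _ => zero_le_one) z
  have hfin : IsFiniteMeasure ν := ⟨by rw [hν _ MeasurableSet.univ]; exact ENNReal.ofReal_lt_top⟩
  have hac : ν ≪ P := by
    refine Measure.AbsolutelyContinuous.mk fun B hB h0 => ?_
    have : indicatorConstLp p hB (measure_ne_top P B) (1 : ℝ) = 0 := by
      refine Lp.ext ?_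
      filter_upwards [indicatorConstLp_coeFn (p := p) (hs := hB)
        (hμs := measure_ne_top P B) (c := (1 : ℝ)), Lp.coeFn_zero ℝ p P,
        measure_eq_zero_iff_ae_notMem.1 h0] with z h1 h2 h3
      rw [h1, h2, Set.indicator_of_notMem h3, Pi.zero_apply]
    rw [hν B hB, this, map_zero, ENNReal.ofReal_zero]
  have hmeas : Measurable (ν.rnDeriv P) := Measure.measurable_rnDeriv ν P
  have hden : P.withDensity (ν.rnDeriv P) = ν := Measure.withDensity_rnDeriv_eq ν P hac
  have hlt : ∀ᵐ z ∂P, ν.rnDeriv P z < ∞ := Measure.rnDeriv_lt_top ν P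
  have hle : ∀ g, ENNReal.ofReal (φ g) ≤ ENNReal.ofReal ‖φ‖ * ‖g‖ₑ := fun g => by
    rw [← ofReal_norm, ← ENNReal.ofReal_mul (norm_nonneg _)]
    exact ENNReal.ofReal_le_ofReal ((le_abs_self _).trans (φ.le_opNorm g))
  -- For `q = ∞` one has `p = 1`, and `ν B ≤ ‖φ‖ * P B` bounds the density almost everywhere. For
  -- finite `q` the converse Hölder inequality applies.
  have hmem : MemLp (fun z => (ν.rnDeriv P z).toReal) q P := by
    rcases eq_or_ne q ∞ with rfl | hq
    · have hp1 : p = 1 := by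
        have : ENNReal.HolderConjugate ∞ p := ENNReal.HolderConjugate.symm
        have := ENNReal.HolderConjugate.top_one
        exact ENNReal.HolderConjugate.unique ∞ p 1
      subst hp1
      have hae : ν.rnDeriv P ≤ᵐ[P] fun _ => ENNReal.ofReal ‖φ‖ := by
        refine ae_le_of_forall_setLIntegral_le_of_sigmaFinite hmeas fun B hB _ => ?_
        rw [← withDensity_apply _ hB, hden, hν B hB, setLIntegral_const]
        refine (hle _).trans ?_
        gcongr
        refine enorm_indicatorConstLp_le.trans ?_
        simp
      refine memLp_top_of_bound hmeas.ennreal_toReal.aestronglyMeasurable ‖φ‖ ?_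
      filter_upwards [hae] with z hz
      rw [Real.norm_of_nonneg ENNReal.toReal_nonneg]
      exact ENNReal.toReal_le_of_le_ofReal (norm_nonneg _) hz
    · have hrs := ENNReal.HolderConjugate.toReal_of_ne_top (p := p) (q := q) hp hq
      have hp0 : p ≠ 0 := (zero_lt_one.trans_le (Fact.out : 1 ≤ p)).ne'
      have hq0 : q ≠ 0 := (zero_lt_one.trans_le (Fact.out : 1 ≤ q)).ne'
      have hbound : ∫⁻ z, ν.rnDeriv P z ^ q.toReal ∂P ≤ ENNReal.ofReal ‖φ‖ ^ q.toReal := by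
        refine lintegral_rpow_le_of_forall_simpleFunc hmeas hrs fun G => ?_
        have hG : MemLp (fun z => (G z : ℝ)) p P :=
          (G.map ((↑) : ℝ≥0 → ℝ)).memLp_of_isFiniteMeasure p P
        have h1 := lintegral_simpleFunc_eq_functional φ hφ hν G hG
        rw [← hden, lintegral_withDensity_eq_lintegral_mul _ hmeas
          (by exact G.measurable.coe_nnreal_ennreal)] at h1
        simp only [Pi.mul_apply] at h1
        rw [h1]
        refine (hle _).trans ?_
        gcongr
        rw [Lp.enorm_toLp, eLpNorm_eq_lintegral_rpow_enorm_toReal hp0 hp, one_div]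
        simp
      refine ⟨hmeas.ennreal_toReal.aestronglyMeasurable, ?_⟩
      rw [eLpNorm_lt_top_iff_lintegral_rpow_enorm_lt_top hq0 hq]
      refine lt_of_le_of_lt (le_of_eq (lintegral_congr_ae ?_)) (hbound.trans_lt
        (ENNReal.rpow_lt_top_of_nonneg ENNReal.toReal_nonneg ENNReal.ofReal_ne_top))
      filter_upwards [hlt] with z hz
      rw [Real.enorm_eq_ofReal ENNReal.toReal_nonneg, ENNReal.ofReal_toReal hz.ne]
  let F : Lp ℝ q P := hmem.toLp
  refine ⟨F, fun g => ?_⟩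
  have : ENNReal.HolderConjugate q p := ENNReal.HolderConjugate.symm
  let B := (ContinuousLinearMap.mul ℝ ℝ).lpPairing P q p F
  have hB : ∀ g : Lp ℝ p P, B g = ∫ z, F z * g z ∂P := fun g =>
    ContinuousLinearMap.lpPairing_eq_integral _ _ _
  rw [← hB]
  -- Both sides are linear and continuous in `g`, so indicators suffice; there the identity is the
  -- definition of `ν`.
  induction g using Lp.induction hp with
  | @indicatorConst c s hs hμs =>
    rw [Lp.simpleFunc.coe_indicatorConst]
    have h1 : indicatorConstLp p hs hμs.ne c =
        c • indicatorConstLp p hs (measure_ne_top P s) (1 : ℝ) := by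
      refine Lp.ext ?_
      filter_upwards [indicatorConstLp_coeFn (p := p) (hs := hs) (hμs := hμs.ne) (c := c),
        Lp.coeFn_smul c (indicatorConstLp p hs (measure_ne_top P s) (1 : ℝ)),
        indicatorConstLp_coeFn (p := p) (hs := hs)
          (hμs := measure_ne_top P s) (c := (1 : ℝ))] with z h1 h2 h3
      rw [h1, h2, Pi.smul_apply, h3]
      by_cases hz : z ∈ s <;> simp [hz]
    rw [h1, map_smul, map_smul]
    congr 1
    rw [hB]
    have h2 : ∫ z, F z * (indicatorConstLp p hs (measure_ne_top P s) (1 : ℝ)) z ∂P =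
        ∫ z in s, (ν.rnDeriv P z).toReal ∂P := by
      rw [← integral_indicator hs]
      refine integral_congr_ae ?_
      filter_upwards [hmem.coeFn_toLp (p := q), indicatorConstLp_coeFn (p := p) (hs := hs)
          (hμs := measure_ne_top P s) (c := (1 : ℝ))] with z h1 h2
      rw [h1, h2]
      by_cases hz : z ∈ s <;> simp [hz]
    rw [h2, integral_toReal hmeas.aemeasurable (ae_restrict_of_ae hlt),
      ← withDensity_apply _ hs, hden, hν s hs, ENNReal.toReal_ofReal (hnn s hs)]
  | add hf hg _ h1 h2 => rw [map_add, map_add, h1, h2]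
  | isClosed => exact isClosed_eq B.continuous φ.continuous

end Representation

/-! ### Weak* compactness and metrizability of the ambiguity sets. -/

namespace RobustMDP

section Pairing

variable {Z : Type*} [MeasurableSpace Z] {P : Measure Z} {p q : ℝ≥0∞}

lemma integrable_Lp_mul_Lp (hpq : ENNReal.HolderConjugate p q) (f : Lp ℝ q P) (g : Lp ℝ p P) :
    Integrable (fun z => f z * g z) P :=
  have := hpq.symm
  (Lp.memLp f).integrable_mul (Lp.memLp g)

lemma abs_integral_Lp_mul_Lp_le (hpq : ENNReal.HolderConjugate p q) (f : Lp ℝ q P)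
    (g : Lp ℝ p P) : |∫ z, f z * g z ∂P| ≤ ‖f‖ * ‖g‖ := by
  have := hpq.symm
  let h := (ContinuousLinearMap.mul ℝ ℝ).holder 1 f g
  have h1 : ∫ z, f z * g z ∂P = ∫ z, h z ∂P :=
    (integral_congr_ae ((ContinuousLinearMap.mul ℝ ℝ).coeFn_holder f g)).symm
  rw [h1, ← L1.integral_eq_integral, ← Real.norm_eq_abs]
  refine (L1.norm_integral_le h).trans
    (((ContinuousLinearMap.mul ℝ ℝ).norm_holder_apply_apply_le f g).trans ?_)
  rw [mul_assoc]
  exact mul_le_of_le_one_left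
    (mul_nonneg ENNReal.toReal_nonneg ENNReal.toReal_nonneg) (ContinuousLinearMap.opNorm_mul_le ℝ ℝ)

lemma integral_Lp_mul_add (hpq : ENNReal.HolderConjugate p q) (f : Lp ℝ q P) (g h : Lp ℝ p P) :
    ∫ z, f z * (g + h) z ∂P = ∫ z, f z * g z ∂P + ∫ z, f z * h z ∂P := by
  rw [← integral_add (integrable_Lp_mul_Lp hpq f g) (integrable_Lp_mul_Lp hpq f h)]
  refine integral_congr_ae ?_
  filter_upwards [Lp.coeFn_add g h] with z hz
  rw [hz, Pi.add_apply, mul_add]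

lemma integral_Lp_mul_smul (f : Lp ℝ q P) (c : ℝ) (g : Lp ℝ p P) :
    ∫ z, f z * (c • g) z ∂P = c * ∫ z, f z * g z ∂P := by
  rw [← integral_const_mul]
  refine integral_congr_ae ?_
  filter_upwards [Lp.coeFn_smul c g] with z hz
  rw [hz, Pi.smul_apply, smul_eq_mul]
  ring

/-- The functional on `L^p` given by an element of `L^q`. -/
noncomputable def dualMap (P : Measure Z) (p q : ℝ≥0∞) (f : Lp ℝ q P) (g : Lp ℝ p P) : ℝ := ∫ z, f z * g z ∂P

/-- Turns the weak* topology into pointwise convergence of functionals, so that compactness can be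
checked in a product of real lines. -/
lemma isInducing_dualMap :
    @IsInducing _ _ (weakStarTopology P p q) _ (dualMap P p q) := by
  let _ := weakStarTopology P p q
  refine ⟨?_⟩
  change (⨅ g : Lp ℝ p P, _) = TopologicalSpace.induced _ (⨅ g : Lp ℝ p P, _)
  rw [induced_iInf]
  simp only [induced_compose]
  rfl

lemma continuous_dualMap_apply [Fact (1 ≤ p)] (hpq : ENNReal.HolderConjugate p q) (f : Lp ℝ q P) :
    Continuous (dualMap P p q f) := by
  let F : Lp ℝ p P →ₗ[ℝ] ℝ :=
    { toFun := dualMap P p q f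
      map_add' := integral_Lp_mul_add hpq f
      map_smul' := integral_Lp_mul_smul f }
  exact (F.mkContinuous ‖f‖ fun g => abs_integral_Lp_mul_Lp_le hpq f g).continuous

lemma dualMap_injective [IsFiniteMeasure P] [Fact (1 ≤ q)] :
    Function.Injective (dualMap P p q) := by
  intro f₁ f₂ h
  refine Lp.ext (Integrable.ae_eq_of_forall_setIntegral_eq _ _ ((Lp.memLp f₁).integrable Fact.out)
    ((Lp.memLp f₂).integrable Fact.out) fun B hB _ => ?_)
  have h1 : ∀ f : Lp ℝ q P, ∫ z in B, f z ∂P =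
      dualMap P p q f (indicatorConstLp p hB (measure_ne_top P B) (1 : ℝ)) := by
    intro f
    rw [dualMap, ← integral_indicator hB]
    refine integral_congr_ae ?_
    filter_upwards [indicatorConstLp_coeFn (p := p) (hs := hB)
      (hμs := measure_ne_top P B) (c := (1 : ℝ))] with z hz
    rw [hz]
    by_cases hzB : z ∈ B <;> simp [hzB]
  rw [h1, h1, h]

/-- A norm bounded weak* closed set of nonnegative elements of `L^q = (L^p)'` is weak* compact. -/
lemma isCompact_dualMap_image [IsProbabilityMeasure P] [Fact (1 ≤ p)] [Fact (1 ≤ q)]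
    (hpq : ENNReal.HolderConjugate p q) (hp : p ≠ ∞) {Q : Set (Lp ℝ q P)}
    (hQ : @IsClosed _ (weakStarTopology P p q) Q) (hpos : ∀ f ∈ Q, 0 ≤ᵐ[P] f) {K : ℝ}
    (hK : ∀ f ∈ Q, ‖f‖ ≤ K) : IsCompact (dualMap P p q '' Q) := by
  -- Each defining condition of `T` is pointwise closed. A limit of the image of `Q` is therefore
  -- still a bounded positive linear functional, hence represented in `L^q`.
  let T : Set (Lp ℝ p P → ℝ) := {φ | (∀ g h, φ (g + h) = φ g + φ h) ∧
    (∀ (c : ℝ) g, φ (c • g) = c * φ g) ∧ (∀ g, |φ g| ≤ K * ‖g‖) ∧ ∀ g, 0 ≤ g → 0 ≤ φ g}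
  have hT : IsClosed T := by
    have e : ∀ g : Lp ℝ p P, Continuous fun φ : Lp ℝ p P → ℝ => φ g := fun g => continuous_apply g
    have h1 : IsClosed {φ : Lp ℝ p P → ℝ | ∀ g h, φ (g + h) = φ g + φ h} := by
      simp only [Set.ofPred_forall]
      exact isClosed_iInter fun g => isClosed_iInter fun h => isClosed_eq (e _) ((e _).add (e _))
    have h2 : IsClosed {φ : Lp ℝ p P → ℝ | ∀ (c : ℝ) g, φ (c • g) = c * φ g} := by
      simp only [Set.ofPred_forall]
      exact isClosed_iInter fun c => isClosed_iInter fun g =>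
        isClosed_eq (e _) (continuous_const.mul (e _))
    have h3 : IsClosed {φ : Lp ℝ p P → ℝ | ∀ g, |φ g| ≤ K * ‖g‖} := by
      simp only [Set.ofPred_forall]
      exact isClosed_iInter fun g => isClosed_le (e _).abs continuous_const
    have h4 : IsClosed {φ : Lp ℝ p P → ℝ | ∀ g, 0 ≤ g → 0 ≤ φ g} := by
      simp only [Set.ofPred_forall]
      exact isClosed_iInter fun g => isClosed_iInter fun _ => isClosed_le continuous_const (e _)
    exact h1.inter (h2.inter (h3.inter h4))
  have hsub : dualMap P p q '' Q ⊆ T := by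
    rintro _ ⟨f, hf, rfl⟩
    refine ⟨integral_Lp_mul_add hpq f, integral_Lp_mul_smul f, fun g => ?_, fun g hg => ?_⟩
    · exact (abs_integral_Lp_mul_Lp_le hpq f g).trans
        (mul_le_mul_of_nonneg_right (hK f hf) (norm_nonneg _))
    · refine integral_nonneg_of_ae ?_
      filter_upwards [hpos f hf, (Lp.coeFn_nonneg g).2 hg] with z h1 h2
      exact mul_nonneg h1 h2
  have hcl : IsClosed (dualMap P p q '' Q) := by
    refine isClosed_of_closure_subset fun φ hφ => ?_
    obtain ⟨h1, h2, h3, h4⟩ := closure_minimal hsub hT hφ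
    let F : Lp ℝ p P →ₗ[ℝ] ℝ := { toFun := φ, map_add' := h1, map_smul' := h2 }
    obtain ⟨f, hf⟩ := exists_Lp_eq_positive_functional (q := q) hp (F.mkContinuous K h3) h4
    have hfφ : dualMap P p q f = φ := funext hf
    refine ⟨f, ?_, hfφ⟩
    -- The representing element lies in the weak* closure of `Q`, which is `Q`.
    let _ := weakStarTopology P p q
    have hI : IsInducing (dualMap P p q) := isInducing_dualMap
    rw [← hQ.closure_eq, hI.closure_eq_preimage_closure_image]
    exact Set.mem_preimage.2 (hfφ ▸ hφ)
  have hbox : IsCompact (Set.univ.pi fun g : Lp ℝ p P => Set.Icc (-(K * ‖g‖)) (K * ‖g‖)) :=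
    isCompact_univ_pi fun g => isCompact_Icc
  exact hbox.of_isClosed_subset hcl fun φ hφ g _ => abs_le.1 ((hsub hφ).2.2.1 g)

end Pairing

variable {A Z : Type*} [MeasurableSpace A] [MeasurableSpace Z] {N : ℕ} {p q : ℝ≥0∞}

lemma one_le_p (M : RobustMDP A Z N p q) : 1 ≤ p :=
  have := M.holder
  ENNReal.HolderConjugate.one_le p q

lemma p_ne_top (M : RobustMDP A Z N p q) : p ≠ ∞ := by
  have := M.holder
  exact ((ENNReal.HolderConjugate.lt_top_iff_one_lt p q).2 M.one_lt_q).ne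

instance (M : RobustMDP A Z N p q) (n : Fin N) : BorelSpace (M.Amb n) := ⟨rfl⟩

instance (M : RobustMDP A Z N p q) (n : Fin N) : Nonempty (M.Amb n) :=
  (M.Q_nonempty n).to_subtype

lemma isInducing_dualMap_amb (M : RobustMDP A Z N p q) (n : Fin N) :
    IsInducing (fun f : M.Amb n => dualMap (M.P n) p q f.1) := by
  let _ := weakStarTopology (M.P n) p q
  exact isInducing_dualMap.comp (g := dualMap (M.P n) p q) (f := fun f : M.Amb n => f.1) ⟨rfl⟩

lemma continuous_integral_amb (M : RobustMDP A Z N p q) (n : Fin N) (g : Lp ℝ p (M.P n)) :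
    Continuous fun f : M.Amb n => ∫ z, f.1 z * g z ∂(M.P n) :=
  (continuous_apply g).comp (M.isInducing_dualMap_amb n).continuous

lemma compactSpace_amb (M : RobustMDP A Z N p q) (n : Fin N) (hQ : M.WeakStarClosed)
    (hK : ∃ K : ℝ, ∀ n : Fin N, ∀ f ∈ M.Q n, ‖f‖ ≤ K) : CompactSpace (M.Amb n) := by
  have := M.prob n
  have : Fact (1 ≤ p) := ⟨M.one_le_p⟩
  have : Fact (1 ≤ q) := ⟨M.one_lt_q.le⟩
  obtain ⟨K, hK⟩ := hK
  have h := isCompact_dualMap_image M.holder M.p_ne_top (hQ n)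
    (fun f hf => (M.Q_density n f hf).1) (hK n)
  refine ⟨(M.isInducing_dualMap_amb n).isCompact_iff.2 ?_⟩
  convert h using 1
  ext φ
  constructor
  · rintro ⟨f, -, rfl⟩
    exact ⟨f.1, f.2, rfl⟩
  · rintro ⟨f, hf, rfl⟩
    exact ⟨⟨f, hf⟩, trivial, rfl⟩

/-- Separability of `P` and `p < ∞` make `L^p` separable. Evaluation on a dense sequence separates
densities, and a continuous injection of a compact space into a Hausdorff space is a closed
embedding. -/
lemma exists_isClosedEmbedding_amb (M : RobustMDP A Z N p q) (n : Fin N) (hQ : M.WeakStarClosed)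
    (hK : ∃ K : ℝ, ∀ n : Fin N, ∀ f ∈ M.Q n, ‖f‖ ≤ K) :
    ∃ F : M.Amb n → ℕ → ℝ, IsClosedEmbedding F := by
  have := M.prob n
  have := M.separable n
  have : Fact (1 ≤ p) := ⟨M.one_le_p⟩
  have : Fact (1 ≤ q) := ⟨M.one_lt_q.le⟩
  have : Fact (p ≠ ∞) := ⟨M.p_ne_top⟩
  have := M.compactSpace_amb n hQ hK
  let e := TopologicalSpace.denseSeq (Lp ℝ p (M.P n))
  refine ⟨fun f k => dualMap (M.P n) p q f.1 (e k), Continuous.isClosedEmbedding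
    (continuous_pi fun k => M.continuous_integral_amb n (e k)) fun f₁ f₂ h => ?_⟩
  refine Subtype.ext (dualMap_injective (p := p) ?_)
  exact Continuous.ext_on (TopologicalSpace.denseRange_denseSeq _)
    (continuous_dualMap_apply M.holder f₁.1) (continuous_dualMap_apply M.holder f₂.1)
    (by rintro _ ⟨k, rfl⟩; exact congrFun h k)

lemma metrizableSpace_amb (M : RobustMDP A Z N p q) (n : Fin N) (hQ : M.WeakStarClosed)
    (hK : ∃ K : ℝ, ∀ n : Fin N, ∀ f ∈ M.Q n, ‖f‖ ≤ K) :
    TopologicalSpace.MetrizableSpace (M.Amb n) :=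
  have ⟨_, hF⟩ := M.exists_isClosedEmbedding_amb n hQ hK
  hF.isEmbedding.metrizableSpace

lemma secondCountableTopology_amb (M : RobustMDP A Z N p q) (n : Fin N) (hQ : M.WeakStarClosed)
    (hK : ∃ K : ℝ, ∀ n : Fin N, ∀ f ∈ M.Q n, ‖f‖ ≤ K) :
    SecondCountableTopology (M.Amb n) :=
  have ⟨_, hF⟩ := M.exists_isClosedEmbedding_amb n hQ hK
  hF.isEmbedding.secondCountableTopology

end RobustMDP

/-! ### Joint semicontinuity of the one-stage operator. -/

lemma tendsto_eLpNorm_of_dominated {Z ι : Type*} [MeasurableSpace Z] {P : Measure Z} {p : ℝ≥0∞}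
    (hp0 : p ≠ 0) (hp : p ≠ ∞) {l : Filter ι} [l.IsCountablyGenerated] {F : ι → Z → ℝ} {g : Z → ℝ}
    (hF : ∀ᶠ i in l, Measurable (F i)) (hg : MemLp g p P) (hFg : ∀ᶠ i in l, ∀ z, |F i z| ≤ g z)
    (hlim : ∀ z, Tendsto (fun i => F i z) l (𝓝 0)) :
    Tendsto (fun i => eLpNorm (F i) p P) l (𝓝 0) := by
  have hp' : 0 < p.toReal := ENNReal.toReal_pos hp0 hp
  have h1 : Tendsto (fun i => ∫⁻ z, ‖F i z‖ₑ ^ p.toReal ∂P) l (𝓝 (∫⁻ _, 0 ∂P)) := by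
    refine tendsto_lintegral_filter_of_dominated_convergence (fun z => ‖g z‖ₑ ^ p.toReal) ?_ ?_
      (lintegral_rpow_enorm_lt_top_of_eLpNorm_lt_top hp0 hp hg.2).ne ?_
    · filter_upwards [hF] with i hi
      exact hi.enorm.pow_const _
    · filter_upwards [hFg] with i hi
      refine Eventually.of_forall fun z => ENNReal.rpow_le_rpow ?_ hp'.le
      rw [enorm_le_iff_norm_le, Real.norm_eq_abs, Real.norm_eq_abs]
      exact (hi z).trans (le_abs_self _)
    · refine Eventually.of_forall fun z => ?_
      have h2 : Tendsto (fun i => ‖F i z‖ₑ ^ p.toReal) l (𝓝 (‖(0 : ℝ)‖ₑ ^ p.toReal)) :=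
        ((ENNReal.continuous_rpow_const.comp continuous_enorm).tendsto (0 : ℝ)).comp (hlim z)
      simpa [ENNReal.zero_rpow_of_pos hp'] using h2
  have h3 := (ENNReal.continuous_rpow_const (y := 1 / p.toReal)).tendsto (∫⁻ _ : Z, 0 ∂P)
  simp only [lintegral_zero] at h1 h3
  rw [ENNReal.zero_rpow_of_pos (by positivity)] at h3
  refine (h3.comp h1).congr fun i => ?_
  rw [eLpNorm_eq_lintegral_rpow_enorm_toReal hp0 hp]
  rfl

/-- Cutting `t` off at its value `t w₀` upgrades lower semicontinuity to convergence, which makes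
limit theorems applicable. -/
lemma LowerSemicontinuousOn.tendsto_min {W : Type*} [TopologicalSpace W] {S : Set W} {t : W → ℝ}
    (ht : LowerSemicontinuousOn t S) {w₀ : W} (hw₀ : w₀ ∈ S) :
    Tendsto (fun w => min (t w) (t w₀)) (𝓝[S] w₀) (𝓝 (t w₀)) := by
  refine tendsto_order.2 ⟨fun a ha => ?_, fun b hb =>
    Eventually.of_forall fun w => (min_le_right _ _).trans_lt hb⟩
  filter_upwards [ht w₀ hw₀ a ha] with w hw
  exact lt_min hw ha

/-- Evaluate `u` at the truncation `min (t w) (t w₀)`, which converges to `t w₀`; monotonicity then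
passes from the truncation to `t w`. -/
lemma LowerSemicontinuousOn.comp_monotone {W : Type*} [TopologicalSpace W] {S : Set W}
    {u : W × ℝ → ℝ} (hu : LowerSemicontinuousOn u (S ×ˢ Set.univ))
    (hmono : ∀ w ∈ S, Monotone fun y => u (w, y)) {t : W → ℝ} (ht : LowerSemicontinuousOn t S) :
    LowerSemicontinuousOn (fun w => u (w, t w)) S := by
  intro w₀ hw₀ y hy
  have hT : Tendsto (fun w => (w, min (t w) (t w₀))) (𝓝[S] w₀) (𝓝[S ×ˢ Set.univ] (w₀, t w₀)) := by
    refine tendsto_nhdsWithin_iff.2 ⟨(tendsto_nhdsWithin_of_tendsto_nhds tendsto_id).prodMk_nhds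
      (ht.tendsto_min hw₀), ?_⟩
    filter_upwards [self_mem_nhdsWithin] with w hw using ⟨hw, trivial⟩
  filter_upwards [hT.eventually (hu (w₀, t w₀) ⟨hw₀, trivial⟩ y hy), self_mem_nhdsWithin]
    with w h1 h2
  exact h1.trans_le (hmono w h2 (min_le_left _ _))

namespace RobustMDP

variable {A Z : Type*} [MeasurableSpace A] [MeasurableSpace Z] {N : ℕ} {p q : ℝ≥0∞}
  {M : RobustMDP A Z N p q} {blo bhi : ℝ → ℝ}

/-- Cost of one stage plus terminal cost `v`. -/
def stageCost (M : RobustMDP A Z N p q) (n : Fin N) (v : ℝ → ℝ) (w : ℝ × A) (z : Z) : ℝ :=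
  M.c n w.1 w.2 (M.T n w.1 w.2 z) + v (M.T n w.1 w.2 z)

lemma measurable_T_section (M : RobustMDP A Z N p q) {n : Fin N} {w : ℝ × A} (hw : w ∈ M.D n) :
    Measurable fun z => M.T n w.1 w.2 z :=
  (M.measurable_T n).comp (f := fun z : Z => ((⟨w, hw⟩ : M.D n), z))
    (measurable_const.prodMk measurable_id)

lemma integral_law (M : RobustMDP A Z N p q) {n : Fin N} (f : M.Amb n) (h : Z → ℝ) :
    ∫ z, h z ∂(M.law f) = ∫ z, f.1 z * h z ∂(M.P n) := by
  rw [law, integral_withDensity_eq_integral_toReal_smul₀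
    (Lp.aestronglyMeasurable f.1).aemeasurable.ennreal_ofReal
    (Eventually.of_forall fun _ => ENNReal.ofReal_lt_top)]
  refine integral_congr_ae ?_
  filter_upwards [(M.Q_density n f.1 f.2).1] with z hz
  rw [ENNReal.toReal_ofReal hz, smul_eq_mul]

lemma integrable_law (M : RobustMDP A Z N p q) {n : Fin N} (f : M.Amb n) {h : Z → ℝ}
    (hh : MemLp h p (M.P n)) : Integrable h (M.law f) := by
  rw [law, integrable_withDensity_iff_integrable_smul₀'
    (Lp.aestronglyMeasurable f.1).aemeasurable.ennreal_ofReal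
    (Eventually.of_forall fun _ => ENNReal.ofReal_lt_top)]
  refine (integrable_Lp_mul_Lp M.holder f.1 hh.toLp).congr ?_
  filter_upwards [(M.Q_density n f.1 f.2).1, hh.coeFn_toLp] with z hz h2
  rw [ENNReal.toReal_ofReal hz, smul_eq_mul, h2]

lemma integral_law_eq_dualMap (M : RobustMDP A Z N p q) {n : Fin N} (f : M.Amb n) {h : Z → ℝ}
    (hh : MemLp h p (M.P n)) : ∫ z, h z ∂(M.law f) = dualMap (M.P n) p q f.1 hh.toLp := by
  rw [integral_law, dualMap]
  refine integral_congr_ae ?_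
  filter_upwards [hh.coeFn_toLp] with z h2
  rw [h2]

lemma continuous_integral_law (M : RobustMDP A Z N p q) {n : Fin N} {h : Z → ℝ}
    (hh : MemLp h p (M.P n)) : Continuous fun f : M.Amb n => ∫ z, h z ∂(M.law f) := by
  simp only [M.integral_law_eq_dualMap _ hh]
  exact M.continuous_integral_amb n hh.toLp

variable [TopologicalSpace A]

lemma BoundingAssumption.blo_nonpos (hb : M.BoundingAssumption blo bhi) (x : ℝ) : blo x ≤ 0 := by
  obtain ⟨_, _, _, _, h, _, _, _, h', _⟩ := hb.bounds
  linarith [h' x]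

lemma BoundingAssumption.bhi_nonneg (hb : M.BoundingAssumption blo bhi) (x : ℝ) : 0 ≤ bhi x := by
  obtain ⟨_, _, _, _, _, h, _, _, _, h', _⟩ := hb.bounds
  linarith [h' x]

lemma BoundingAssumption.one_le (hb : M.BoundingAssumption blo bhi) (x : ℝ) :
    1 ≤ bhi x - blo x := by
  obtain ⟨_, _, _, _, _, _, h, _, h1, h2, _⟩ := hb.bounds
  linarith [h1 x, h2 x]

lemma RealAssumption.monotone_c (hr : M.RealAssumption) {n : Fin N} {w : ℝ × A} (hw : w ∈ M.D n) :
    Monotone (M.c n w.1 w.2) :=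
  fun _ _ h => hr.mono_c n _ _ _ _ _ le_rfl h hw hw

/-- Measurability of the cost in the next state comes from its monotonicity. -/
lemma measurable_stageCost (hr : M.RealAssumption) {v : ℝ → ℝ} (hv : v ∈ valueSpace blo bhi)
    {n : Fin N} {w : ℝ × A} (hw : w ∈ M.D n) : Measurable (M.stageCost n v w) :=
  ((hr.monotone_c hw).measurable.comp (M.measurable_T_section hw)).add
    (hv.1.comp (M.measurable_T_section hw))

lemma exists_memLp_stageCost_le (hb : M.BoundingAssumption blo bhi) {v : ℝ → ℝ}
    (hv : v ∈ valueSpace blo bhi) {n : Fin N} {w₀ : ℝ × A} (hw₀ : w₀ ∈ M.D n) :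
    ∃ Θ : Z → ℝ, MemLp Θ p (M.P n) ∧ ∀ᶠ w in 𝓝[M.D n] w₀, ∀ z, |M.stageCost n v w z| ≤ Θ z := by
  obtain ⟨Θ₁, Θ₂, -, -, -, -, h1, h2, h⟩ := hb.locallyDominated n w₀ hw₀
  obtain ⟨lam, hlam, hvb⟩ := hv.2.1
  refine ⟨fun z => Θ₁ z + lam * Θ₂ z, h1.add (h2.const_mul lam), ?_⟩
  filter_upwards [h] with w hw z
  refine (abs_add_le _ _).trans (add_le_add (hw z).1 ((hvb _).trans ?_))
  exact mul_le_mul_of_nonneg_left (hw z).2 hlam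

lemma memLp_stageCost (hb : M.BoundingAssumption blo bhi) (hr : M.RealAssumption) {v : ℝ → ℝ}
    (hv : v ∈ valueSpace blo bhi) {n : Fin N} {w : ℝ × A} (hw : w ∈ M.D n) :
    MemLp (M.stageCost n v w) p (M.P n) := by
  obtain ⟨Θ, h1, h2⟩ := exists_memLp_stageCost_le hb hv hw
  refine h1.mono (measurable_stageCost hr hv hw).aestronglyMeasurable
    (Eventually.of_forall fun z => ?_)
  exact (h2.self_of_nhdsWithin hw z).trans (le_abs_self _)

lemma lowerSemicontinuousOn_stageCost (hr : M.RealAssumption) {v : ℝ → ℝ}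
    (hv : v ∈ valueSpace blo bhi) (n : Fin N) (z : Z) :
    LowerSemicontinuousOn (fun w => M.stageCost n v w z) (M.D n) := by
  refine LowerSemicontinuousOn.comp_monotone
    (u := fun w : (ℝ × A) × ℝ => M.c n w.1.1 w.1.2 w.2 + v w.2) ((hr.lsc_c n).add ?_)
    (fun w hw => (hr.monotone_c hw).add hv.2.2.2) (hr.lsc_T n z)
  exact (hv.2.2.1.comp continuous_snd).lowerSemicontinuousOn _

lemma continuous_L (hb : M.BoundingAssumption blo bhi) (hr : M.RealAssumption) {v : ℝ → ℝ}
    (hv : v ∈ valueSpace blo bhi) {n : Fin N} {x : ℝ} {a : A} (ha : (x, a) ∈ M.D n) :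
    Continuous (M.L n v x a) :=
  M.continuous_integral_law (memLp_stageCost hb hr hv ha)

/-- With `d` the negative part of the increment of the stage cost from `(x₀, a₀)`, taken with its
sign, `L` at `(x, a, f)` is at least `L` at `(x₀, a₀, f)` plus `∫ d`. The first term is weak*
continuous in `f`. The second is at most `K ‖d‖_p` in absolute value, uniformly in `f`, and tends to
zero by dominated convergence. -/
lemma lowerSemicontinuousOn_L [FirstCountableTopology A] (hb : M.BoundingAssumption blo bhi)
    (hr : M.RealAssumption) {v : ℝ → ℝ} (hv : v ∈ valueSpace blo bhi) (n : Fin N) :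
    LowerSemicontinuousOn (fun w : (ℝ × M.Amb n) × A => M.L n v w.1.1 w.2 w.1.2)
      {w | (w.1.1, w.2) ∈ M.D n} := by
  have := M.prob n
  rintro ⟨⟨x₀, f₀⟩, a₀⟩ hw₀ y hy
  simp only at hy
  replace hw₀ : (x₀, a₀) ∈ M.D n := hw₀
  obtain ⟨Θ, hΘ, hdom⟩ := exists_memLp_stageCost_le hb hv hw₀
  obtain ⟨K, hK⟩ := hb.normBounded
  let h : ℝ × A → Z → ℝ := M.stageCost n v
  let d : ℝ × A → Z → ℝ := fun w z => min (h w z) (h (x₀, a₀) z) - h (x₀, a₀) z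
  have hdm : ∀ w ∈ M.D n, MemLp (d w) p (M.P n) := fun w hw =>
    ((memLp_stageCost hb hr hv hw).inf (memLp_stageCost hb hr hv hw₀)).sub
      (memLp_stageCost hb hr hv hw₀)
  have hmem : ∀ᶠ w in 𝓝[M.D n] (x₀, a₀), w ∈ M.D n := self_mem_nhdsWithin
  have hlim : Tendsto (fun w => eLpNorm (d w) p (M.P n)) (𝓝[M.D n] (x₀, a₀)) (𝓝 0) := by
    refine tendsto_eLpNorm_of_dominated (zero_lt_one.trans_le M.one_le_p).ne' M.p_ne_top
      (g := fun z => 2 * Θ z) ?_ (hΘ.const_mul 2) ?_ fun z => ?_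
    · filter_upwards [hmem] with w hw
      exact ((measurable_stageCost hr hv hw).min (measurable_stageCost hr hv hw₀)).sub
        (measurable_stageCost hr hv hw₀)
    · filter_upwards [hdom] with w hw z
      have h1 := abs_le.1 (hw z)
      have h2 := abs_le.1 (hdom.self_of_nhdsWithin hw₀ z)
      simp only [d, h]
      rcases min_choice (M.stageCost n v w z) (M.stageCost n v (x₀, a₀) z) with h3 | h3 <;>
        rw [h3, abs_le] <;> constructor <;> linarith
    · have := (lowerSemicontinuousOn_stageCost hr hv n z).tendsto_min hw₀
      simpa [d, h] using this.sub_const (M.stageCost n v (x₀, a₀) z)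
  have hlim' : Tendsto (fun w => K * (eLpNorm (d w) p (M.P n)).toReal) (𝓝[M.D n] (x₀, a₀))
      (𝓝 0) := by
    have := ((ENNReal.tendsto_toReal ENNReal.zero_ne_top).comp hlim).const_mul K
    simpa using this
  have hmap : Tendsto (fun w : (ℝ × M.Amb n) × A => (w.1.1, w.2))
      (𝓝[{w | (w.1.1, w.2) ∈ M.D n}] ((x₀, f₀), a₀)) (𝓝[M.D n] (x₀, a₀)) := by
    refine tendsto_nhdsWithin_iff.2 ⟨tendsto_nhdsWithin_of_tendsto_nhds ?_, self_mem_nhdsWithin⟩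
    exact Continuous.tendsto (f := fun w : (ℝ × M.Amb n) × A => (w.1.1, w.2)) (by fun_prop) _
  have hfst : Tendsto (fun w : (ℝ × M.Amb n) × A => M.L n v x₀ a₀ w.1.2)
      (𝓝[{w | (w.1.1, w.2) ∈ M.D n}] ((x₀, f₀), a₀)) (𝓝 (M.L n v x₀ a₀ f₀)) := by
    refine tendsto_nhdsWithin_of_tendsto_nhds ?_
    exact Continuous.tendsto (f := fun w : (ℝ × M.Amb n) × A => M.L n v x₀ a₀ w.1.2)
      ((continuous_L hb hr hv hw₀).comp (by fun_prop)) _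
  have hsum := hfst.sub (hlim'.comp hmap)
  rw [sub_zero] at hsum
  filter_upwards [hsum.eventually (lt_mem_nhds hy), hmap.eventually hmem] with ⟨⟨x, f⟩, a⟩ h1 h2
  replace h2 : (x, a) ∈ M.D n := h2
  refine h1.trans_le ?_
  have h3 : |∫ z, d (x, a) z ∂(M.law f)| ≤ K * (eLpNorm (d (x, a)) p (M.P n)).toReal := by
    rw [M.integral_law_eq_dualMap f (hdm _ h2)]
    refine (abs_integral_Lp_mul_Lp_le M.holder f.1 _).trans ?_
    rw [Lp.norm_toLp]
    exact mul_le_mul_of_nonneg_right (hK n f.1 f.2) ENNReal.toReal_nonneg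
  have hL0 : M.L n v x₀ a₀ f = ∫ z, M.stageCost n v (x₀, a₀) z ∂(M.law f) := rfl
  have h4 : M.L n v x₀ a₀ f + ∫ z, d (x, a) z ∂(M.law f) ≤ M.L n v x a f := by
    rw [hL0, ← integral_add (M.integrable_law f (memLp_stageCost hb hr hv hw₀))
      (M.integrable_law f (hdm _ h2))]
    refine integral_mono ((M.integrable_law f (memLp_stageCost hb hr hv hw₀)).add
      (M.integrable_law f (hdm _ h2))) (M.integrable_law f (memLp_stageCost hb hr hv h2))
      fun z => ?_
    simp only [d, h, stageCost]
    rw [add_sub_cancel]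
    exact min_le_left _ _
  have h5 := (abs_le.1 h3).1
  simp only [Function.comp_apply]
  linarith

end RobustMDP

/-! ### Bounds, monotonicity and convexity of the one-stage operator. -/

namespace RobustMDP

variable {A Z : Type*} [MeasurableSpace A] [MeasurableSpace Z] {N : ℕ} {p q : ℝ≥0∞}
  {M : RobustMDP A Z N p q} {blo bhi : ℝ → ℝ} [TopologicalSpace A]

lemma enorm_eq_ofReal_add_ofReal_neg (r : ℝ) :
    ‖r‖ₑ = ENNReal.ofReal r + ENNReal.ofReal (-r) := by
  rw [Real.enorm_eq_ofReal_abs]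
  rcases le_total 0 r with h | h
  · rw [abs_of_nonneg h, ENNReal.ofReal_of_nonpos (neg_nonpos.2 h), add_zero]
  · rw [abs_of_nonpos h, ENNReal.ofReal_of_nonpos h, zero_add]

lemma lintegral_enorm_c_le (hb : M.BoundingAssumption blo bhi) (hr : M.RealAssumption)
    {n : Fin N} (f : M.Amb n) {x : ℝ} {a : A} (ha : (x, a) ∈ M.D n) :
    ∫⁻ z, ‖M.c n x a (M.T n x a z)‖ₑ ∂(M.law f) ≤ ENNReal.ofReal (bhi x - blo x) := by
  obtain ⟨α, εlo, εhi, -, -, -, -, -, -, -, h⟩ := hb.bounds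
  obtain ⟨h1, -, h2, -⟩ := h n f x a ha
  have hm : Measurable fun z => M.c n x a (M.T n x a z) :=
    (hr.monotone_c ha).measurable.comp (M.measurable_T_section ha)
  simp only [enorm_eq_ofReal_add_ofReal_neg]
  rw [lintegral_add_left hm.ennreal_ofReal, sub_eq_add_neg,
    ENNReal.ofReal_add (hb.bhi_nonneg x) (neg_nonneg.2 (hb.blo_nonpos x))]
  exact add_le_add h2 h1

lemma exists_lintegral_bound_le (hb : M.BoundingAssumption blo bhi) :
    ∃ α : ℝ, 0 ≤ α ∧ ∀ (n : Fin N) (f : M.Amb n) (x : ℝ) (a : A), (x, a) ∈ M.D n →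
      ∫⁻ z, ENNReal.ofReal (bhi (M.T n x a z) - blo (M.T n x a z)) ∂(M.law f) ≤
        ENNReal.ofReal (α * (bhi x - blo x)) := by
  obtain ⟨α, εlo, εhi, hα, -, -, -, -, -, -, h⟩ := hb.bounds
  refine ⟨α, hα, fun n f x a ha => ?_⟩
  obtain ⟨-, h1, -, h2⟩ := h n f x a ha
  have hm : Measurable fun z => bhi (M.T n x a z) :=
    hb.measurable_bhi.comp (M.measurable_T_section ha)
  have h3 : ∀ y, ENNReal.ofReal (bhi y - blo y) =
      ENNReal.ofReal (bhi y) + ENNReal.ofReal (-blo y) := fun y => by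
    rw [sub_eq_add_neg, ENNReal.ofReal_add (hb.bhi_nonneg y) (neg_nonneg.2 (hb.blo_nonpos y))]
  simp only [h3]
  rw [lintegral_add_left hm.ennreal_ofReal]
  have h4 : α * (bhi x - blo x) = α * bhi x + -(α * blo x) := by ring
  rw [h4, ENNReal.ofReal_add (mul_nonneg hα (hb.bhi_nonneg x))
    (neg_nonneg.2 (mul_nonpos_of_nonneg_of_nonpos hα (hb.blo_nonpos x)))]
  exact add_le_add h2 h1

lemma exists_abs_L_le (hb : M.BoundingAssumption blo bhi) (hr : M.RealAssumption) {v : ℝ → ℝ}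
    (hv : v ∈ valueSpace blo bhi) (n : Fin N) :
    ∃ C : ℝ, 0 ≤ C ∧ ∀ x a, (x, a) ∈ M.D n → ∀ f, |M.L n v x a f| ≤ C * (bhi x - blo x) := by
  obtain ⟨α, hα, h⟩ := exists_lintegral_bound_le hb
  obtain ⟨lam, hlam, hvb⟩ := hv.2.1
  -- The stage cost contributes one multiple of `b x`, and the continuation value at most `lam * α`
  -- multiples.
  refine ⟨1 + lam * α, by positivity, fun x a ha f => ?_⟩
  have hb0 : 0 ≤ bhi x - blo x := zero_le_one.trans (hb.one_le x)
  have hm : Measurable fun z => M.c n x a (M.T n x a z) :=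
    (hr.monotone_c ha).measurable.comp (M.measurable_T_section ha)
  have h1 : ‖M.L n v x a f‖ₑ ≤ ENNReal.ofReal ((1 + lam * α) * (bhi x - blo x)) := by
    calc ‖M.L n v x a f‖ₑ
        ≤ ∫⁻ z, ‖M.c n x a (M.T n x a z) + v (M.T n x a z)‖ₑ ∂(M.law f) :=
          enorm_integral_le_lintegral_enorm _
      _ ≤ ∫⁻ z, (‖M.c n x a (M.T n x a z)‖ₑ + ENNReal.ofReal lam *
            ENNReal.ofReal (bhi (M.T n x a z) - blo (M.T n x a z))) ∂(M.law f) := by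
          refine lintegral_mono fun z => (enorm_add_le _ _).trans (add_le_add le_rfl ?_)
          rw [← ENNReal.ofReal_mul hlam, Real.enorm_eq_ofReal_abs]
          exact ENNReal.ofReal_le_ofReal (hvb _)
      _ = ∫⁻ z, ‖M.c n x a (M.T n x a z)‖ₑ ∂(M.law f) + ENNReal.ofReal lam *
            ∫⁻ z, ENNReal.ofReal (bhi (M.T n x a z) - blo (M.T n x a z)) ∂(M.law f) := by
          rw [lintegral_add_left hm.enorm, lintegral_const_mul' _ _ ENNReal.ofReal_ne_top]
      _ ≤ ENNReal.ofReal (bhi x - blo x) +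
            ENNReal.ofReal lam * ENNReal.ofReal (α * (bhi x - blo x)) := by
          gcongr
          · exact lintegral_enorm_c_le hb hr f ha
          · exact h n f x a ha
      _ = ENNReal.ofReal ((1 + lam * α) * (bhi x - blo x)) := by
          rw [← ENNReal.ofReal_mul hlam, ← ENNReal.ofReal_add hb0 (by positivity)]
          congr 1
          ring
  rw [Real.enorm_eq_ofReal_abs] at h1
  exact (ENNReal.ofReal_le_ofReal_iff (by positivity)).1 h1

lemma L_mono (hb : M.BoundingAssumption blo bhi) (hr : M.RealAssumption) {v : ℝ → ℝ}
    (hv : v ∈ valueSpace blo bhi) {n : Fin N} {x y : ℝ} {a : A} (hxy : x ≤ y)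
    (hx : (x, a) ∈ M.D n) (hy : (y, a) ∈ M.D n) (f : M.Amb n) :
    M.L n v x a f ≤ M.L n v y a f :=
  integral_mono (M.integrable_law f (memLp_stageCost hb hr hv hx))
    (M.integrable_law f (memLp_stageCost hb hr hv hy)) fun z =>
    add_le_add (hr.mono_c n x y _ _ a hxy (hr.mono_T n x y a z hxy hx hy) hx hy)
      (hv.2.2.2 (hr.mono_T n x y a z hxy hx hy))

/-- Cost and continuation value are convex and increasing in the next state, so convexity survives
composition with the convex transition map. -/
lemma L_convex {V : Type*} [AddCommGroup V] [Module ℝ V] {ι : A → V}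
    (hb : M.BoundingAssumption blo bhi) (hr : M.RealAssumption) (hc : M.ConvexModel ι) {v : ℝ → ℝ}
    (hv : v ∈ valueSpace blo bhi) (hvc : ConvexOn ℝ Set.univ v) {n : Fin N} {w₁ w₂ w : ℝ × A}
    (hw₁ : w₁ ∈ M.D n) (hw₂ : w₂ ∈ M.D n) (hw : w ∈ M.D n) {s t : ℝ} (hs : 0 ≤ s) (ht : 0 ≤ t)
    (hst : s + t = 1) (h1 : w.1 = s * w₁.1 + t * w₂.1) (h2 : ι w.2 = s • ι w₁.2 + t • ι w₂.2)
    (f : M.Amb n) :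
    M.L n v w.1 w.2 f ≤ s * M.L n v w₁.1 w₁.2 f + t * M.L n v w₂.1 w₂.2 f := by
  have i₁ := M.integrable_law f (memLp_stageCost hb hr hv hw₁)
  have i₂ := M.integrable_law f (memLp_stageCost hb hr hv hw₂)
  have i := M.integrable_law f (memLp_stageCost hb hr hv hw)
  have h : M.L n v w.1 w.2 f ≤
      ∫ z, (s * M.stageCost n v w₁ z + t * M.stageCost n v w₂ z) ∂(M.law f) := by
    refine integral_mono i ((i₁.const_mul s).add (i₂.const_mul t)) fun z => ?_
    have hT := hc.convex_T n z w₁ hw₁ w₂ hw₂ w hw s t hs ht hst h1 h2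
    have hcost := hc.convex_c n w₁ hw₁ w₂ hw₂ w hw (M.T n w₁.1 w₁.2 z) (M.T n w₂.1 w₂.2 z)
      s t hs ht hst h1 h2
    have hv1 := hvc.2 (Set.mem_univ (M.T n w₁.1 w₁.2 z)) (Set.mem_univ (M.T n w₂.1 w₂.2 z))
      hs ht hst
    simp only [smul_eq_mul] at hv1
    have hc1 := hr.monotone_c hw hT
    have hv2 := hv.2.2.2 hT
    simp only [stageCost]
    linarith
  refine h.trans (le_of_eq ?_)
  rw [integral_add (i₁.const_mul s) (i₂.const_mul t), integral_const_mul, integral_const_mul]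
  rfl

omit [TopologicalSpace A] in
lemma exists_convex_combination {V : Type*} [AddCommGroup V] [Module ℝ V] {ι : A → V}
    (hc : M.ConvexModel ι) {n : Fin N} {w₁ w₂ : ℝ × A} (hw₁ : w₁ ∈ M.D n) (hw₂ : w₂ ∈ M.D n)
    {s t : ℝ} (hs : 0 ≤ s) (ht : 0 ≤ t) (hst : s + t = 1) :
    ∃ w ∈ M.D n, w.1 = s * w₁.1 + t * w₂.1 ∧ ι w.2 = s • ι w₁.2 + t • ι w₂.2 := by
  obtain ⟨w, hw, h⟩ := hc.convex_D n (Set.mem_image_of_mem _ hw₁) (Set.mem_image_of_mem _ hw₂)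
    hs ht hst
  exact ⟨w, hw, congrArg Prod.fst h, congrArg Prod.snd h⟩

omit [TopologicalSpace A] in
-- One mixed law serves all `h` simultaneously; this is the concavity hypothesis in the minimax
-- theorem.
lemma exists_amb_combination (hQ : ∀ n, Convex ℝ (M.Q n)) {n : Fin N} (f₁ f₂ : M.Amb n) {s t : ℝ}
    (hs : 0 ≤ s) (ht : 0 ≤ t) (hst : s + t = 1) :
    ∃ f : M.Amb n, ∀ h : Z → ℝ, MemLp h p (M.P n) →
      ∫ z, h z ∂(M.law f) = s * ∫ z, h z ∂(M.law f₁) + t * ∫ z, h z ∂(M.law f₂) := by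
  suffices ∀ f : M.Amb n, f.1 = s • f₁.1 + t • f₂.1 → ∀ h : Z → ℝ, MemLp h p (M.P n) →
      ∫ z, h z ∂(M.law f) = s * ∫ z, h z ∂(M.law f₁) + t * ∫ z, h z ∂(M.law f₂) from
    ⟨⟨s • f₁.1 + t • f₂.1, hQ n f₁.2 f₂.2 hs ht hst⟩, this _ rfl⟩
  intro f hf h hh
  rw [integral_law, integral_law, integral_law, ← integral_const_mul, ← integral_const_mul]
  have hi : ∀ f : M.Amb n, Integrable (fun z => f.1 z * h z) (M.P n) := fun f => by
    refine (integrable_Lp_mul_Lp M.holder f.1 hh.toLp).congr ?_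
    filter_upwards [hh.coeFn_toLp] with z h2
    rw [h2]
  rw [← integral_add ((hi f₁).const_mul s) ((hi f₂).const_mul t)]
  refine integral_congr_ae ?_
  filter_upwards [Lp.coeFn_add (s • f₁.1) (t • f₂.1), Lp.coeFn_smul s f₁.1,
    Lp.coeFn_smul t f₂.1] with z h1 h2 h3
  rw [hf, h1, Pi.add_apply, h2, h3]
  simp only [Pi.smul_apply, smul_eq_mul]
  ring

end RobustMDP

/-! ### One backward step of the Bellman recursion. -/

namespace RobustMDP

variable {A Z V : Type*} [TopologicalSpace A] [TopologicalSpace.MetrizableSpace A]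
  [SecondCountableTopology A] [MeasurableSpace A] [BorelSpace A] [MeasurableSpace Z]
  [AddCommGroup V] [Module ℝ V] {N : ℕ} {p q : ℝ≥0∞} {M : RobustMDP A Z N p q}
  {blo bhi : ℝ → ℝ} {ι : A → V}

/-- Selection takes place over `ℝ × M.Amb n`, so the reply depends measurably on state and law
together, and the minimal value is jointly lower semicontinuous. -/
lemma exists_argmin_rule (hb : M.BoundingAssumption blo bhi) (hr : M.RealAssumption)
    (hQclosed : M.WeakStarClosed) {v : ℝ → ℝ} (hv : v ∈ valueSpace blo bhi) (n : Fin N) :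
    ∃ d : ℝ × M.Amb n → A, Measurable d ∧ (∀ w : ℝ × M.Amb n, (w.1, d w) ∈ M.D n) ∧
      (∀ (w : ℝ × M.Amb n) a, (w.1, a) ∈ M.D n → M.L n v w.1 (d w) w.2 ≤ M.L n v w.1 a w.2) ∧
      LowerSemicontinuous fun w : ℝ × M.Amb n => M.L n v w.1 (d w) w.2 := by
  have := M.secondCountableTopology_amb n hQclosed hb.normBounded
  refine exists_measurable_argmin (S := {w : (ℝ × M.Amb n) × A | (w.1.1, w.2) ∈ M.D n})
    (φ := fun w a => M.L n v w.1 a w.2) (fun w => ?_) (fun w => hr.compact_D n w.1)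
    (fun w u a hu ha => ?_) (lowerSemicontinuousOn_L hb hr hv n)
  · obtain ⟨s, -, hs⟩ := M.exists_selector n
    exact ⟨s w.1, hs w.1⟩
  · exact hr.usc_D n w.1 (fun k => (u k).1) a ((continuous_fst.tendsto w).comp hu) ha

omit [SecondCountableTopology A] [BorelSpace A] in
lemma lowerSemicontinuousOn_L_section (hb : M.BoundingAssumption blo bhi) (hr : M.RealAssumption)
    {v : ℝ → ℝ} (hv : v ∈ valueSpace blo bhi) {n : Fin N} (f : M.Amb n) :
    LowerSemicontinuousOn (fun w : ℝ × A => M.L n v w.1 w.2 f) (M.D n) :=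
  LowerSemicontinuousOn.comp (f := fun w : (ℝ × M.Amb n) × A => M.L n v w.1.1 w.2 w.1.2)
    (g := fun w : ℝ × A => ((w.1, f), w.2)) (lowerSemicontinuousOn_L hb hr hv n)
    (Continuous.continuousOn (by fun_prop)) fun _ hw => hw

/-- `e x` minimizes the worst-case cost over all laws. If that worst case exceeded `y`, the minimax
theorem would give one law against which every action costs more than `y`, contradicting the
hypothesis on `y`. -/
lemma exists_minimax_rule (hb : M.BoundingAssumption blo bhi) (hr : M.RealAssumption)
    (hc : M.ConvexModel ι) (hQ : ∀ n, Convex ℝ (M.Q n)) (hQclosed : M.WeakStarClosed) {v : ℝ → ℝ}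
    (hv : v ∈ valueSpace blo bhi) (hvc : ConvexOn ℝ Set.univ v) (n : Fin N) :
    ∃ e : ℝ → A, Measurable e ∧ (∀ x, (x, e x) ∈ M.D n) ∧
      ∀ x (y : ℝ), (∀ f, ∃ a, (x, a) ∈ M.D n ∧ M.L n v x a f ≤ y) →
        ∀ f, M.L n v x (e x) f ≤ y := by
  have := M.compactSpace_amb n hQclosed hb.normBounded
  obtain ⟨C, hC, hLC⟩ := exists_abs_L_le hb hr hv n
  have hbdd : ∀ x a, (x, a) ∈ M.D n → BddAbove (Set.range fun f => M.L n v x a f) :=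
    fun x a ha => ⟨C * (bhi x - blo x), by
      rintro _ ⟨f, rfl⟩
      exact (abs_le.1 (hLC x a ha f)).2⟩
  obtain ⟨e, he, hmem, hmin, -⟩ := exists_measurable_argmin (S := M.D n)
    (φ := fun x a => ⨆ f, M.L n v x a f)
    (fun x => have ⟨s, _, hs⟩ := M.exists_selector n; ⟨s x, hs x⟩) (hr.compact_D n)
    (hr.usc_D n) (lowerSemicontinuousOn_ciSup (fun w hw => hbdd w.1 w.2 hw)
      (lowerSemicontinuousOn_L_section hb hr hv))
  refine ⟨e, he, hmem, fun x y hy f => ?_⟩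
  by_contra! hlt
  -- An intermediate level is needed because the minimax theorem weakens `c <` to `c ≤`.
  obtain ⟨c, hyc, hcL⟩ := exists_between hlt
  have : Nonempty A := ⟨e 0⟩
  -- The admissible actions are moved into `V`, the space with the linear structure; the values of
  -- `invFun ι` off `S` play no role.
  let S : Set V := {u | ∃ a, (x, a) ∈ M.D n ∧ ι a = u}
  have hinv : ∀ a, Function.invFun ι (ι a) = a := Function.leftInverse_invFun hc.injective
  have hcomb : ∀ a₁ a₂, (x, a₁) ∈ M.D n → (x, a₂) ∈ M.D n → ∀ s t : ℝ, 0 ≤ s → 0 ≤ t →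
      s + t = 1 → ∃ a, (x, a) ∈ M.D n ∧ ι a = s • ι a₁ + t • ι a₂ := by
    intro a₁ a₂ h₁ h₂ s t hs ht hst
    obtain ⟨⟨x', a⟩, hw, h1, h2⟩ := exists_convex_combination hc h₁ h₂ hs ht hst
    simp only at h1 h2
    rw [← add_mul, hst, one_mul] at h1
    subst h1
    exact ⟨a, hw, h2⟩
  have hcvx : ∀ f : M.Amb n, ConvexOn ℝ S fun u => M.L n v x (Function.invFun ι u) f := by
    intro f
    refine ⟨?_, ?_⟩
    · rintro _ ⟨a₁, h₁, rfl⟩ _ ⟨a₂, h₂, rfl⟩ s t hs ht hst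
      exact hcomb a₁ a₂ h₁ h₂ s t hs ht hst
    · rintro _ ⟨a₁, h₁, rfl⟩ _ ⟨a₂, h₂, rfl⟩ s t hs ht hst
      obtain ⟨a, ha, hιa⟩ := hcomb a₁ a₂ h₁ h₂ s t hs ht hst
      simp only [← hιa, hinv, smul_eq_mul]
      refine L_convex hb hr hc hv hvc h₁ h₂ ha hs ht hst ?_ hιa f
      simp only
      rw [← add_mul, hst, one_mul]
  obtain ⟨f', hf'⟩ := exists_forall_le_of_convex_concave hcvx (c := c)
    (by
      rintro _ ⟨a, ha, rfl⟩
      simp only [hinv]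
      exact (continuous_L hb hr hv ha).upperSemicontinuous)
    (fun f₁ f₂ s t hs ht hst => by
      obtain ⟨f, hf⟩ := exists_amb_combination hQ f₁ f₂ hs ht hst
      refine ⟨f, ?_⟩
      rintro _ ⟨a, ha, rfl⟩
      simp only [hinv]
      exact (hf _ (memLp_stageCost hb hr hv ha)).ge)
    (by
      rintro _ ⟨a, ha, rfl⟩
      simp only [hinv]
      exact exists_lt_of_lt_ciSup
        (hcL.trans_le ((le_ciSup (hbdd x _ (hmem x)) f).trans (hmin x a ha))))
  obtain ⟨a, ha, hay⟩ := hy f'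
  have h1 := hf' (ι a) ⟨a, ha, rfl⟩
  rw [hinv] at h1
  linarith

/-- Decision rules attaining the values in one backward step from `v` to `v'` of the Bellman
recursion: a minimizer `reply` of the controller against every law, a maximizer `law` of nature, and
a rule `robust` of the controller which guarantees `v'` against all laws. -/
structure BellmanStep (M : RobustMDP A Z N p q) (n : Fin N) (v v' : ℝ → ℝ) where
  reply : ℝ × M.Amb n → A
  law : ℝ → M.Amb n
  robust : ℝ → A
  measurable_reply : Measurable reply
  measurable_law : Measurable law
  measurable_robust : Measurable robust
  reply_mem : ∀ x f, (x, reply (x, f)) ∈ M.D n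
  robust_mem : ∀ x, (x, robust x) ∈ M.D n
  reply_le : ∀ x f a, (x, a) ∈ M.D n → M.L n v x (reply (x, f)) f ≤ M.L n v x a f
  le_value : ∀ x f, M.L n v x (reply (x, f)) f ≤ v' x
  value_eq : ∀ x, v' x = M.L n v x (reply (x, law x)) (law x)
  robust_le : ∀ x f, M.L n v x (robust x) f ≤ v' x

/-- After minimization over actions, `L` is lower semicontinuous in the state and, as an infimum of
continuous functions, upper semicontinuous in the law. So nature has a measurable maximizer, and
`v'`, a supremum of lower semicontinuous functions, stays lower semicontinuous. -/
theorem exists_bellmanStep (hb : M.BoundingAssumption blo bhi) (hr : M.RealAssumption)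
    (hc : M.ConvexModel ι) (hQ : ∀ n, Convex ℝ (M.Q n)) (hQclosed : M.WeakStarClosed) {v : ℝ → ℝ}
    (hv : v ∈ valueSpace blo bhi) (hvc : ConvexOn ℝ Set.univ v) (n : Fin N) :
    ∃ v' ∈ valueSpace blo bhi, ConvexOn ℝ Set.univ v' ∧ Nonempty (M.BellmanStep n v v') := by
  have := M.compactSpace_amb n hQclosed hb.normBounded
  have := M.metrizableSpace_amb n hQclosed hb.normBounded
  have := M.secondCountableTopology_amb n hQclosed hb.normBounded
  obtain ⟨d, hd, hdmem, hdmin, hdlsc⟩ := exists_argmin_rule hb hr hQclosed hv n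
  have hlsc : ∀ f : M.Amb n, LowerSemicontinuous fun x => M.L n v x (d (x, f)) f := fun f =>
    hdlsc.comp (g := fun x : ℝ => (x, f)) (by fun_prop)
  have husc : ∀ x, UpperSemicontinuous fun f : M.Amb n => M.L n v x (d (x, f)) f := by
    intro x f₀ y hy
    filter_upwards [((continuous_L hb hr hv (hdmem (x, f₀))).tendsto f₀).eventually
      (gt_mem_nhds hy)] with f hf
    exact (hdmin (x, f) _ (hdmem (x, f₀))).trans_lt hf
  obtain ⟨γ, hγ, hγmax⟩ := exists_measurable_argmax husc hlsc
  obtain ⟨e, he, hemem, hemin⟩ := exists_minimax_rule hb hr hc hQ hQclosed hv hvc n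
  have hlsc' : LowerSemicontinuous fun x => M.L n v x (d (x, γ x)) (γ x) := by
    intro x₀ y hy
    filter_upwards [hlsc (γ x₀) x₀ y hy] with x hx
    exact hx.trans_le (hγmax x _)
  refine ⟨fun x => M.L n v x (d (x, γ x)) (γ x), ⟨hlsc'.measurable, ?_, hlsc', ?_⟩, ?_,
    ⟨⟨d, γ, e, hd, hγ, he, fun x f => hdmem (x, f), hemem, fun x f a => hdmin (x, f) a, hγmax,
      fun x => rfl, fun x f => ?_⟩⟩⟩
  · obtain ⟨C, hC, h⟩ := exists_abs_L_le hb hr hv n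
    exact ⟨C, hC, fun x => h x _ (hdmem (x, γ x)) _⟩
  · intro x y hxy
    -- The reply at the larger state `y` to the law `γ x` is admissible at `x`, since the action
    -- sets shrink as the state grows.
    have hmem := hr.antitone_D n x y _ hxy (hdmem (y, γ x))
    exact (hdmin (x, γ x) _ hmem).trans ((L_mono hb hr hv hxy hmem (hdmem (y, γ x)) _).trans
      (hγmax y (γ x)))
  · refine ⟨convex_univ, fun x₁ _ x₂ _ s t hs ht hst => ?_⟩
    simp only [smul_eq_mul]
    -- The law `γ x` optimal at the mixture is used at `x₁` and `x₂` too, and the two replies to it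
    -- are mixed.
    set x := s * x₁ + t * x₂ with hx
    obtain ⟨⟨x', a⟩, hw, h1, h2⟩ := exists_convex_combination hc (hdmem (x₁, γ x))
      (hdmem (x₂, γ x)) hs ht hst
    simp only [← hx] at h1 h2
    subst h1
    refine (hdmin (_, γ _) a hw).trans ((L_convex hb hr hc hv hvc (hdmem (x₁, γ _))
      (hdmem (x₂, γ _)) hw hs ht hst hx h2 _).trans ?_)
    exact add_le_add (mul_le_mul_of_nonneg_left (hγmax x₁ _) hs)
      (mul_le_mul_of_nonneg_left (hγmax x₂ _) ht)
  · exact hemin x _ (fun f => ⟨d (x, f), hdmem (x, f), hγmax x f⟩) f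

end RobustMDP

/-! ### Markov property of the state process. -/

namespace RobustMDP

section Path

variable {A Z : Type*} [MeasurableSpace A] [MeasurableSpace Z] {N : ℕ} {p q : ℝ≥0∞}
  {M : RobustMDP A Z N p q} (σ : M.Profile)

lemma Profile.step_apply (n : Fin N) (x : ℝ) :
    σ.step n x = (M.law (σ.amb n x)).map fun z => M.T n x (σ.act n x) z := by
  rw [step, Kernel.map_apply _ (σ.measurable_next n), Kernel.prod_apply, Kernel.id_apply,
    Measure.dirac_prod, Measure.map_map (σ.measurable_next n) (by fun_prop)]
  rfl

lemma Profile.kernel_apply {k : ℕ} (hk : k < N) (h : (i : Finset.Iic k) → ℝ) :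
    σ.kernel k h = σ.step ⟨k, hk⟩ (h ⟨k, Finset.mem_Iic.2 le_rfl⟩) := by
  simp only [kernel, Kernel.comap_apply, dif_pos hk]

instance (n : ℕ) (x : ℝ) : IsProbabilityMeasure (σ.pathLaw n x) := by
  unfold Profile.pathLaw
  infer_instance

lemma Profile.map_pathLaw_self (n : ℕ) (x : ℝ) :
    (σ.pathLaw n x).map (fun ω => ω n) = Measure.dirac x := by
  have h1 : (σ.pathLaw n x).map (Preorder.frestrictLe n) =
      Measure.dirac (fun _ : Finset.Iic n => x) := by
    rw [pathLaw, Kernel.traj_map_frestrictLe_apply, Kernel.partialTraj_self, Kernel.id_apply]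
  have h2 := congrArg (Measure.map fun h : (i : Finset.Iic n) → ℝ =>
    h ⟨n, Finset.mem_Iic.2 le_rfl⟩) h1
  rw [Measure.map_map (by fun_prop) (by fun_prop), Measure.map_dirac' (by fun_prop)] at h2
  exact h2

/-- A trajectory started at time `n` can be restarted at time `k` from its history, and the next
transition depends only on the last state of that history. -/
lemma Profile.map_pathLaw_succ {n k : ℕ} (hnk : n ≤ k) (hk : k < N) (x : ℝ) :
    (σ.pathLaw n x).map (fun ω => (ω k, ω (k + 1))) =
      ((σ.pathLaw n x).map fun ω => ω k) ⊗ₘ σ.step ⟨k, hk⟩ := by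
  refine Measure.ext_of_lintegral _ fun g hg => ?_
  rw [lintegral_map hg (by fun_prop), Measure.lintegral_compProd hg,
    lintegral_map (hg.lintegral_kernel_prod_right') (by fun_prop)]
  have h1 := Kernel.partialTraj_compProd_traj (X := fun _ => ℝ) (κ := σ.kernel) hnk (fun _ => x)
  have hg' : Measurable fun w : ((i : Finset.Iic k) → ℝ) × (ℕ → ℝ) =>
      g (w.1 ⟨k, Finset.mem_Iic.2 le_rfl⟩, w.2 (k + 1)) := hg.comp (by fun_prop)
  have h2 := congrArg (fun μ : Measure (((i : Finset.Iic k) → ℝ) × (ℕ → ℝ)) =>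
    ∫⁻ w, g (w.1 ⟨k, Finset.mem_Iic.2 le_rfl⟩, w.2 (k + 1)) ∂μ) h1
  rw [lintegral_map hg' (by fun_prop), Measure.lintegral_compProd hg',
    ← Kernel.traj_map_frestrictLe_apply,
    lintegral_map hg'.lintegral_kernel_prod_right' (by fun_prop)] at h2
  refine Eq.trans h2.symm (lintegral_congr fun ω => ?_)
  have h3 : (Kernel.traj σ.kernel k (Preorder.frestrictLe k ω)).map (fun ω' => ω' (k + 1)) =
      σ.step ⟨k, hk⟩ (ω k) := by
    rw [← Kernel.map_apply _ (by fun_prop), Kernel.map_traj_succ_self, σ.kernel_apply hk]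
    rfl
  rw [← h3, lintegral_map (by fun_prop) (by fun_prop)]
  rfl

lemma Profile.map_pathLaw_pair {n : ℕ} {k : Fin N} (hnk : n ≤ k) (x : ℝ) :
    (σ.pathLaw n x).map (fun ω => (ω k, ω (k + 1))) =
      ((σ.pathLaw n x).map fun ω => ω k) ⊗ₘ σ.step k :=
  σ.map_pathLaw_succ hnk k.2 x

lemma Profile.lintegral_step (k : Fin N) (x : ℝ) {g : ℝ → ℝ≥0∞} (hg : Measurable g) :
    ∫⁻ y, g y ∂(σ.step k x) = ∫⁻ z, g (M.T k x (σ.act k x) z) ∂(M.law (σ.amb k x)) := by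
  have hT : Measurable fun z => M.T k x (σ.act k x) z :=
    (σ.measurable_next k).comp measurable_prodMk_left
  rw [σ.step_apply, lintegral_map hg hT]

lemma Profile.integral_step (k : Fin N) (x : ℝ) {g : ℝ → ℝ} (hg : Measurable g) :
    ∫ y, g y ∂(σ.step k x) = ∫ z, g (M.T k x (σ.act k x) z) ∂(M.law (σ.amb k x)) := by
  have hT : Measurable fun z => M.T k x (σ.act k x) z :=
    (σ.measurable_next k).comp measurable_prodMk_left
  rw [σ.step_apply, integral_map hT.aemeasurable hg.aestronglyMeasurable]

lemma Profile.lintegral_pathLaw_pair {n : ℕ} {k : Fin N} (hnk : n ≤ k) (x : ℝ) {g : ℝ → ℝ → ℝ≥0∞}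
    (hg : Measurable (Function.uncurry g)) :
    ∫⁻ ω, g (ω k) (ω (k + 1)) ∂(σ.pathLaw n x) =
      ∫⁻ ω, ∫⁻ z, g (ω k) (M.T k (ω k) (σ.act k (ω k)) z) ∂(M.law (σ.amb k (ω k)))
        ∂(σ.pathLaw n x) := by
  have hpair : Measurable fun ω : ℕ → ℝ => (ω k, ω (k + 1)) := by fun_prop
  have h1 : ∫⁻ ω, g (ω k) (ω (k + 1)) ∂(σ.pathLaw n x) =
      ∫⁻ w, Function.uncurry g w ∂((σ.pathLaw n x).map fun ω => (ω k, ω (k + 1))) :=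
    (lintegral_map hg hpair).symm
  rw [h1, σ.map_pathLaw_pair hnk, Measure.lintegral_compProd hg,
    lintegral_map hg.lintegral_kernel_prod_right' (measurable_pi_apply _)]
  exact lintegral_congr fun ω => σ.lintegral_step k (ω k) (hg.comp measurable_prodMk_left)

end Path

end RobustMDP

/-! ### Integrability and the verification identity. -/

namespace RobustMDP

section Verification

variable {A Z : Type*} [TopologicalSpace A] [MeasurableSpace A] [MeasurableSpace Z]
  {N : ℕ} {p q : ℝ≥0∞} {M : RobustMDP A Z N p q} {blo bhi : ℝ → ℝ} (σ : M.Profile)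

/-- The expectation of `b` grows by at most the factor `α` per stage, whatever the profile. All
later integrability rests on this. -/
lemma Profile.lintegral_bound_lt_top (hb : M.BoundingAssumption blo bhi) {n k : ℕ} (hnk : n ≤ k)
    (hk : k ≤ N) (x : ℝ) :
    ∫⁻ ω, ENNReal.ofReal (bhi (ω k) - blo (ω k)) ∂(σ.pathLaw n x) < ∞ := by
  have hm : Measurable fun y => ENNReal.ofReal (bhi y - blo y) :=
    (hb.measurable_bhi.sub hb.measurable_blo).ennreal_ofReal
  obtain ⟨α, hα, h⟩ := exists_lintegral_bound_le hb
  induction k, hnk using Nat.le_induction with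
  | base =>
    rw [← lintegral_map (μ := σ.pathLaw n x) (f := fun y => ENNReal.ofReal (bhi y - blo y))
      (g := fun ω => ω n) hm (by fun_prop), σ.map_pathLaw_self, lintegral_dirac' _ hm]
    exact ENNReal.ofReal_lt_top
  | succ k hnk ih =>
    have hk' : k < N := hk
    rw [σ.lintegral_pathLaw_pair (k := ⟨k, hk'⟩) hnk x
      (g := fun _ y => ENNReal.ofReal (bhi y - blo y)) (hm.comp measurable_snd)]
    calc _ ≤ ∫⁻ ω, ENNReal.ofReal α * ENNReal.ofReal (bhi (ω k) - blo (ω k))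
          ∂(σ.pathLaw n x) := by
          refine lintegral_mono fun ω => ?_
          rw [← ENNReal.ofReal_mul hα]
          exact h _ _ _ _ (σ.act_mem ⟨k, hk'⟩ (ω k))
      _ < ∞ := by
          rw [lintegral_const_mul' _ _ ENNReal.ofReal_ne_top]
          exact ENNReal.mul_lt_top ENNReal.ofReal_lt_top (ih hk'.le)

lemma Profile.integrable_value (hb : M.BoundingAssumption blo bhi) {v : ℝ → ℝ}
    (hv : v ∈ valueSpace blo bhi) {n k : ℕ} (hnk : n ≤ k) (hk : k ≤ N) (x : ℝ) :
    Integrable (fun ω => v (ω k)) (σ.pathLaw n x) := by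
  obtain ⟨lam, hlam, h⟩ := hv.2.1
  refine ⟨(hv.1.comp (measurable_pi_apply k)).aestronglyMeasurable, ?_⟩
  calc ∫⁻ ω, ‖v (ω k)‖ₑ ∂(σ.pathLaw n x)
      ≤ ∫⁻ ω, ENNReal.ofReal lam * ENNReal.ofReal (bhi (ω k) - blo (ω k)) ∂(σ.pathLaw n x) := by
        refine lintegral_mono fun ω => ?_
        rw [← ENNReal.ofReal_mul hlam, Real.enorm_eq_ofReal_abs]
        exact ENNReal.ofReal_le_ofReal (h _)
    _ < ∞ := by
        rw [lintegral_const_mul' _ _ ENNReal.ofReal_ne_top]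
        exact ENNReal.mul_lt_top ENNReal.ofReal_lt_top (σ.lintegral_bound_lt_top hb hnk hk x)

variable [SecondCountableTopology A] [BorelSpace A]

lemma Profile.measurable_c (hr : M.RealAssumption) (k : Fin N) :
    Measurable fun w : ℝ × ℝ => M.c k w.1 (σ.act k w.1) w.2 := by
  have h1 : LowerSemicontinuous fun w : M.D k × ℝ => M.c k w.1.1.1 w.1.1.2 w.2 :=
    lowerSemicontinuousOn_univ_iff.1 (LowerSemicontinuousOn.comp
      (f := fun w : (ℝ × A) × ℝ => M.c k w.1.1 w.1.2 w.2)
      (g := fun w : M.D k × ℝ => ((w.1 : ℝ × A), w.2)) (hr.lsc_c k)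
      (Continuous.continuousOn (by fun_prop)) fun w _ => ⟨w.1.2, trivial⟩)
  exact h1.measurable.comp (f := fun w : ℝ × ℝ =>
    ((⟨(w.1, σ.act k w.1), σ.act_mem k w.1⟩ : M.D k), w.2))
    ((Measurable.subtype_mk (measurable_fst.prodMk
      ((σ.measurable_act k).comp measurable_fst))).prodMk measurable_snd)

lemma Profile.integrable_c (hb : M.BoundingAssumption blo bhi) (hr : M.RealAssumption) {n : ℕ}
    {k : Fin N} (hnk : n ≤ k) (x : ℝ) :
    Integrable (fun ω => M.c k (ω k) (σ.act k (ω k)) (ω (k + 1))) (σ.pathLaw n x) := by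
  have hm := σ.measurable_c hr k
  refine ⟨(hm.comp (f := fun ω : ℕ → ℝ => (ω k, ω (k + 1))) (by fun_prop)).aestronglyMeasurable,
    ?_⟩
  refine lt_of_le_of_lt ?_ (σ.lintegral_bound_lt_top hb hnk k.2.le x)
  rw [σ.lintegral_pathLaw_pair hnk x (g := fun y y' => ‖M.c k y (σ.act k y) y'‖ₑ) hm.enorm]
  exact lintegral_mono fun ω => lintegral_enorm_c_le hb hr _ (σ.act_mem k (ω k))

/-- Expected stage cost plus continuation value, conditioned on the present state. -/
lemma Profile.integral_c_add_value (hb : M.BoundingAssumption blo bhi) (hr : M.RealAssumption)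
    {v : ℝ → ℝ} (hv : v ∈ valueSpace blo bhi) {n : ℕ} {k : Fin N} (hnk : n ≤ k) (x : ℝ) :
    Integrable (fun ω => M.L k v (ω k) (σ.act k (ω k)) (σ.amb k (ω k))) (σ.pathLaw n x) ∧
    ∫ ω, M.c k (ω k) (σ.act k (ω k)) (ω (k + 1)) ∂(σ.pathLaw n x) +
      ∫ ω, v (ω (k + 1)) ∂(σ.pathLaw n x) =
      ∫ ω, M.L k v (ω k) (σ.act k (ω k)) (σ.amb k (ω k)) ∂(σ.pathLaw n x) := by
  let φ : ℝ × ℝ → ℝ := fun w => M.c k w.1 (σ.act k w.1) w.2 + v w.2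
  have hφ : Measurable φ := (σ.measurable_c hr k).add (hv.1.comp measurable_snd)
  have hpair : Measurable fun ω : ℕ → ℝ => (ω k, ω (k + 1)) := by fun_prop
  have hi1 := σ.integrable_c hb hr hnk x
  have hi2 := σ.integrable_value hb hv (Nat.le_succ_of_le hnk) k.2 x
  have hi : Integrable φ ((σ.pathLaw n x).map fun ω => (ω k, ω (k + 1))) :=
    (integrable_map_measure hφ.aestronglyMeasurable hpair.aemeasurable).2 (hi1.add hi2)
  have hL : ∀ y, ∫ y', φ (y, y') ∂(σ.step k y) = M.L k v y (σ.act k y) (σ.amb k y) := fun y =>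
    σ.integral_step k y (hφ.comp measurable_prodMk_left)
  have hpath := σ.map_pathLaw_pair hnk x
  have h1 := hpath ▸ hi
  have h2 : Integrable (fun y => ∫ y', φ (y, y') ∂(σ.step k y))
      ((σ.pathLaw n x).map fun ω => ω k) := Integrable.integral_compProd h1
  have h3 := Measure.integral_compProd h1
  rw [← hpath, integral_map hpair.aemeasurable hφ.aestronglyMeasurable,
    integral_map (measurable_pi_apply _).aemeasurable h2.aestronglyMeasurable] at h3
  simp only [hL] at h2 h3
  refine ⟨(integrable_map_measure h2.aestronglyMeasurable
    (measurable_pi_apply _).aemeasurable).1 h2, ?_⟩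
  rw [← integral_add hi1 hi2, ← h3]

/-- The gap between a candidate value function and the value of a profile is the expected sum of the
one-stage gaps. -/
theorem Profile.sub_value_eq (hb : M.BoundingAssumption blo bhi) (hr : M.RealAssumption)
    {v : ℕ → ℝ → ℝ} (hv : ∀ k ≤ N, v k ∈ valueSpace blo bhi) (hvN : v N = M.cN) {n : ℕ}
    (hn : n ≤ N) (x : ℝ) :
    v n x - σ.value n x = ∑ k ∈ Finset.univ.filter (fun k : Fin N => n ≤ (k : ℕ)),
      ∫ ω, (v k (ω k) - M.L k (v (k + 1)) (ω k) (σ.act k (ω k)) (σ.amb k (ω k)))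
        ∂(σ.pathLaw n x) := by
  have hval : σ.value n x = ∑ k ∈ Finset.univ.filter (fun k : Fin N => n ≤ (k : ℕ)),
      ∫ ω, M.c k (ω k) (σ.act k (ω k)) (ω (k + 1)) ∂(σ.pathLaw n x) +
        ∫ ω, v N (ω N) ∂(σ.pathLaw n x) := by
    unfold value totalCost
    rw [hvN, integral_add, integral_finsetSum]
    · exact fun k hk => σ.integrable_c hb hr (Finset.mem_filter.1 hk).2 x
    · exact integrable_finsetSum _
        fun k hk => σ.integrable_c hb hr (Finset.mem_filter.1 hk).2 x
    · have := σ.integrable_value hb (hv N le_rfl) hn le_rfl x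
      rwa [hvN] at this
  -- Telescoping of the expectations of `v k (ω k)`; the initial term is `v n x` because the path
  -- sits at `x` at time `n`.
  have htel : ∀ m, n ≤ m → m ≤ N →
      v n x = ∑ k ∈ Finset.univ.filter (fun k : Fin N => n ≤ (k : ℕ) ∧ (k : ℕ) < m),
        (∫ ω, v k (ω k) ∂(σ.pathLaw n x) - ∫ ω, v (k + 1) (ω (k + 1)) ∂(σ.pathLaw n x)) +
        ∫ ω, v m (ω m) ∂(σ.pathLaw n x) := by
    intro m hm
    induction m, hm using Nat.le_induction with
    | base =>
      intro _
      have hmeas := (hv n hn).1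
      rw [Finset.filter_false_of_mem (by omega), Finset.sum_empty, zero_add,
        ← integral_map (μ := σ.pathLaw n x) (f := v n) (φ := fun ω => ω n) (measurable_pi_apply n).aemeasurable
          hmeas.aestronglyMeasurable, σ.map_pathLaw_self,
        integral_dirac' _ _ hmeas.stronglyMeasurable]
    | succ m hnm ih =>
      intro hm
      rw [ih (Nat.le_of_succ_le hm)]
      have hins : Finset.univ.filter (fun k : Fin N => n ≤ (k : ℕ) ∧ (k : ℕ) < m + 1) =
          insert ⟨m, hm⟩ (Finset.univ.filter fun k : Fin N => n ≤ (k : ℕ) ∧ (k : ℕ) < m) := by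
        ext k
        simp only [Finset.mem_filter, Finset.mem_univ, true_and, Finset.mem_insert, Fin.ext_iff]
        omega
      rw [hins, Finset.sum_insert (by simp)]
      ring
  have hfil : Finset.univ.filter (fun k : Fin N => n ≤ (k : ℕ) ∧ (k : ℕ) < N) =
      Finset.univ.filter (fun k : Fin N => n ≤ (k : ℕ)) :=
    Finset.filter_congr fun k _ => by simp
  rw [htel N hn le_rfl, hval, hfil, add_sub_add_right_eq_sub, ← Finset.sum_sub_distrib]
  refine Finset.sum_congr rfl fun k hk => ?_
  have hnk : n ≤ (k : ℕ) := (Finset.mem_filter.1 hk).2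
  obtain ⟨hi, h⟩ := σ.integral_c_add_value hb hr (hv (k + 1) k.2) hnk x
  rw [integral_sub (σ.integrable_value hb (hv k k.2.le) hnk k.2.le x) hi, ← h]
  ring

/-- All one-stage gaps are nonnegative here; in `Profile.le_value` they are all nonpositive. -/
lemma Profile.value_le (hb : M.BoundingAssumption blo bhi) (hr : M.RealAssumption)
    {v : ℕ → ℝ → ℝ} (hv : ∀ k ≤ N, v k ∈ valueSpace blo bhi) (hvN : v N = M.cN)
    (h : ∀ (k : Fin N) y, M.L k (v (k + 1)) y (σ.act k y) (σ.amb k y) ≤ v k y) {n : ℕ}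
    (hn : n ≤ N) (x : ℝ) : σ.value n x ≤ v n x := by
  rw [← sub_nonneg, σ.sub_value_eq hb hr hv hvN hn]
  exact Finset.sum_nonneg fun k _ => integral_nonneg fun ω => sub_nonneg.2 (h k _)

lemma Profile.le_value (hb : M.BoundingAssumption blo bhi) (hr : M.RealAssumption)
    {v : ℕ → ℝ → ℝ} (hv : ∀ k ≤ N, v k ∈ valueSpace blo bhi) (hvN : v N = M.cN)
    (h : ∀ (k : Fin N) y, v k y ≤ M.L k (v (k + 1)) y (σ.act k y) (σ.amb k y)) {n : ℕ}
    (hn : n ≤ N) (x : ℝ) : v n x ≤ σ.value n x := by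
  rw [← sub_nonpos, σ.sub_value_eq hb hr hv hvN hn]
  exact Finset.sum_nonpos fun k _ => integral_nonpos fun ω => sub_nonpos.2 (h k _)

end Verification

end RobustMDP

/-! ### Backward recursion and comparison of the two games. -/

namespace RobustMDP

variable {A Z V : Type*} [TopologicalSpace A] [MeasurableSpace A] [MeasurableSpace Z]
  [AddCommGroup V] [Module ℝ V] {N : ℕ} {p q : ℝ≥0∞} {M : RobustMDP A Z N p q}
  {blo bhi : ℝ → ℝ} {ι : A → V}

omit [TopologicalSpace A] in
lemma BellmanStep.infL_eq {n : Fin N} {v v' : ℝ → ℝ} (s : M.BellmanStep n v v') (x : ℝ)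
    (f : M.Amb n) : M.infL n v x f = (M.L n v x (s.reply (x, f)) f : EReal) :=
  le_antisymm (iInf_le_of_le ⟨_, s.reply_mem x f⟩ le_rfl)
    (le_iInf fun a => EReal.coe_le_coe (s.reply_le x f a.1 a.2))

omit [TopologicalSpace A] in
lemma BellmanStep.supInf_eq {n : Fin N} {v v' : ℝ → ℝ} (s : M.BellmanStep n v v') (x : ℝ) :
    M.supInf n v x = (v' x : EReal) := by
  refine le_antisymm (iSup_le fun f => ?_) (le_iSup_of_le (s.law x) ?_)
  · rw [s.infL_eq]
    exact EReal.coe_le_coe (s.le_value x f)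
  · rw [s.infL_eq, ← s.value_eq]

lemma cN_mem_valueSpace (hb : M.BoundingAssumption blo bhi) (hr : M.RealAssumption) :
    M.cN ∈ valueSpace blo bhi := by
  refine ⟨hr.lsc_cN.measurable, ⟨1, zero_le_one, fun x => ?_⟩, hr.lsc_cN, hr.mono_cN⟩
  have h1 := hb.terminal x
  have h2 := hb.blo_nonpos x
  have h3 := hb.bhi_nonneg x
  rw [one_mul, abs_le]
  constructor <;> linarith

omit [TopologicalSpace A] in
-- Weak duality: a leader's policy becomes a follower's policy by ignoring the opponent's move, and
-- the two orders of play then produce the same profile.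
lemma natureFirstValue_le_robustValue (M : RobustMDP A Z N p q) (n : ℕ) (x : ℝ) :
    M.natureFirstValue n x ≤ M.robustValue n x := by
  refine iSup_le fun γ => le_iInf fun π => ?_
  let π' : M.FollowerController :=
    { rule := fun k w => π.rule k w.1
      measurable_rule := fun k => (π.measurable_rule k).comp measurable_fst
      rule_mem := fun k y _ => π.rule_mem k y }
  let γ' : M.FollowerNature :=
    { rule := fun k w => γ.rule k w.1
      measurable_rule := fun k => (γ.measurable_rule k).comp measurable_fst }
  exact (iInf_le _ π').trans (le_iSup (fun γ' => ((controllerFirst π γ').value n x : EReal)) γ')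

variable [TopologicalSpace.MetrizableSpace A] [SecondCountableTopology A] [BorelSpace A]

/-- Solution of the Bellman equation by backward recursion. -/
lemma exists_bellman_solution (hb : M.BoundingAssumption blo bhi) (hr : M.RealAssumption)
    (hc : M.ConvexModel ι) (hQ : ∀ n, Convex ℝ (M.Q n)) (hQclosed : M.WeakStarClosed) :
    ∃ v : ℕ → ℝ → ℝ, v N = M.cN ∧ (∀ k, v k ∈ valueSpace blo bhi) ∧
      Nonempty (∀ n : Fin N, M.BellmanStep n (v (n + 1)) (v n)) := by
  let G := {v : ℝ → ℝ // v ∈ valueSpace blo bhi ∧ ConvexOn ℝ Set.univ v}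
  have hstep : ∀ (n : Fin N) (g : G), ∃ g' : G, Nonempty (M.BellmanStep n g.1 g'.1) := by
    intro n g
    obtain ⟨v', h1, h2, h3⟩ := exists_bellmanStep hb hr hc hQ hQclosed g.2.1 g.2.2 n
    exact ⟨⟨v', h1, h2⟩, h3⟩
  choose Φ hΦ using hstep
  -- The index counts remaining stages, so step `i` acts at stage `N - 1 - i`. The default branch
  -- occurs only for `N = 0`; iterates beyond `N` are never used.
  let w : ℕ → G := fun j => Nat.rec ⟨M.cN, cN_mem_valueSpace hb hr, hc.convex_cN⟩
    (fun i g => if h : N - 1 - i < N then Φ ⟨N - 1 - i, h⟩ g else g) j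
  have hw : ∀ n : Fin N, w (N - n) = Φ n (w (N - (n + 1))) := by
    intro n
    have h1 : N - (n : ℕ) = (N - (n + 1)) + 1 := by omega
    have h2 : N - 1 - (N - ((n : ℕ) + 1)) = n := by omega
    have h3 : w (N - (n + 1) + 1) = if h : N - 1 - (N - ((n : ℕ) + 1)) < N then
      Φ ⟨_, h⟩ (w (N - (n + 1))) else w (N - (n + 1)) := rfl
    rw [h1, h3]
    simp only [h2, n.2, dif_pos, Fin.eta]
  refine ⟨fun k => (w (N - k)).1, ?_, fun k => (w (N - k)).2.1, ⟨fun n => ?_⟩⟩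
  · simp only [Nat.sub_self]
    rfl
  · have := hΦ n (w (N - (n + 1)))
    rw [← hw] at this
    exact this.some

end RobustMDP

theorem mainTheorem3 {A Z V : Type*}
    [TopologicalSpace A] [TopologicalSpace.MetrizableSpace A] [SecondCountableTopology A]
    [MeasurableSpace A] [BorelSpace A] [StandardBorelSpace A] [MeasurableSpace Z]
    [AddCommGroup V] [Module ℝ V] {N : ℕ} {p q : ℝ≥0∞}
    (M : RobustMDP A Z N p q) (blo bhi : ℝ → ℝ) (ι : A → V)
    (hbound : M.BoundingAssumption blo bhi) (hreal : M.RealAssumption)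
    (hconvex : M.ConvexModel ι) (hQconvex : ∀ n, Convex ℝ (M.Q n)) (hQclosed : M.WeakStarClosed) :
    -- `v n` is the (finite) value function of the game in which nature moves first
    ∃ v : ℕ → ℝ → ℝ,
      (∀ n ≤ N, ∀ x, M.natureFirstValue n x = (v n x : EReal)) ∧
      (∀ n ≤ N, v n ∈ RobustMDP.valueSpace blo bhi) ∧
      -- Bellman equation
      (∀ x, v N x = M.cN x) ∧
      (∀ (n : Fin N) (x : ℝ), (v n x : EReal) = M.supInf n (v (n + 1)) x) ∧
      -- existence of decision rules attaining the supremum and the infimum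
      (∃ (γ : M.LeaderNature) (π : M.FollowerController),
        (∀ (n : Fin N) (x : ℝ),
          M.infL n (v (n + 1)) x (γ.rule n x) = M.supInf n (v (n + 1)) x) ∧
        (∀ (n : Fin N) (x : ℝ) (f : M.Amb n),
          (M.L n (v (n + 1)) x (π.rule n (x, f)) f : EReal) = M.infL n (v (n + 1)) x f) ∧
        (∀ (n : Fin N) (x : ℝ),
          v n x = M.L n (v (n + 1)) x (π.rule n (x, γ.rule n x)) (γ.rule n x))) ∧
      -- all decision rules solving the Bellman equation induce a pair with the optimal value
      (∀ (γ : M.LeaderNature) (π : M.FollowerController),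
        (∀ (n : Fin N) (x : ℝ),
          v n x = M.L n (v (n + 1)) x (π.rule n (x, γ.rule n x)) (γ.rule n x)) →
        ∀ n ≤ N, ∀ x, (RobustMDP.natureFirst π γ).value n x = v n x) ∧
      -- equality with the robust value, and optimality of all maximizing rules of nature
      (∀ n ≤ N, ∀ x, M.robustValue n x = M.natureFirstValue n x) ∧
      (∀ γ : M.LeaderNature,
        (∀ (n : Fin N) (x : ℝ),
          M.infL n (v (n + 1)) x (γ.rule n x) = M.supInf n (v (n + 1)) x) →
        ∀ n ≤ N, ∀ x, M.natureFirstValue n x = RobustMDP.naturePolicyValue γ n x) := by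
  obtain ⟨v, hvN, hv, ⟨s⟩⟩ :=
    RobustMDP.exists_bellman_solution hbound hreal hconvex hQconvex hQclosed
  have hv' : ∀ k ≤ N, v k ∈ RobustMDP.valueSpace blo bhi := fun k _ => hv k
  let γs : M.LeaderNature :=
    { rule := fun n => (s n).law
      measurable_rule := fun n => (s n).measurable_law }
  let πs : M.FollowerController :=
    { rule := fun n => (s n).reply
      measurable_rule := fun n => (s n).measurable_reply
      rule_mem := fun n => (s n).reply_mem }
  let ρ : M.LeaderController :=
    { rule := fun n => (s n).robust
      measurable_rule := fun n => (s n).measurable_robust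
      rule_mem := fun n => (s n).robust_mem }
  have hγs : ∀ (n : Fin N) (x : ℝ),
      M.infL n (v (n + 1)) x (γs.rule n x) = M.supInf n (v (n + 1)) x := fun n x => by
    rw [(s n).infL_eq, (s n).supInf_eq, (s n).value_eq]
  -- Needed for every maximizing rule: the selected one bounds the value from below, and the general
  -- case is the final optimality claim.
  have hlower : ∀ γ : M.LeaderNature, (∀ (n : Fin N) (x : ℝ),
      M.infL n (v (n + 1)) x (γ.rule n x) = M.supInf n (v (n + 1)) x) →
      ∀ n ≤ N, ∀ x, (v n x : EReal) ≤ RobustMDP.naturePolicyValue γ n x := by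
    intro γ hγ n hn x
    refine le_iInf fun π => EReal.coe_le_coe ?_
    refine (RobustMDP.natureFirst π γ).le_value hbound hreal hv' hvN (fun k y => ?_) hn x
    rw [← EReal.coe_le_coe_iff, ← (s k).supInf_eq, ← hγ k y]
    exact iInf_le_of_le ⟨π.rule k (y, γ.rule k y), π.rule_mem k y _⟩ le_rfl
  have hnature : ∀ n ≤ N, ∀ x, M.natureFirstValue n x = (v n x : EReal) := by
    intro n hn x
    have hupper : ∀ γ : M.LeaderNature, (RobustMDP.natureFirst πs γ).value n x ≤ v n x := fun γ =>
      (RobustMDP.natureFirst πs γ).value_le hbound hreal hv' hvN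
        (fun k y => (s k).le_value y (γ.rule k y)) hn x
    exact le_antisymm (iSup_le fun γ => iInf_le_of_le πs (EReal.coe_le_coe (hupper γ)))
      ((hlower γs hγs n hn x).trans (le_iSup (fun γ => RobustMDP.naturePolicyValue γ n x) γs))
  refine ⟨v, hnature, hv', fun x => congrFun hvN x, fun n x => ((s n).supInf_eq x).symm,
    ⟨γs, πs, hγs, fun n x f => ((s n).infL_eq x f).symm, fun n x => (s n).value_eq x⟩, ?_, ?_, ?_⟩
  · intro γ π h n hn x
    exact le_antisymm
      ((RobustMDP.natureFirst π γ).value_le hbound hreal hv' hvN (fun k y => (h k y).ge) hn x)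
      ((RobustMDP.natureFirst π γ).le_value hbound hreal hv' hvN (fun k y => (h k y).le) hn x)
  · intro n hn x
    refine le_antisymm ?_ (M.natureFirstValue_le_robustValue n x)
    rw [hnature n hn x]
    -- The robust rule guarantees `v` at each stage against every law, hence also against laws
    -- chosen after seeing the action.
    have hupper : ∀ γ : M.FollowerNature, (RobustMDP.controllerFirst ρ γ).value n x ≤ v n x :=
      fun γ => (RobustMDP.controllerFirst ρ γ).value_le hbound hreal hv' hvN
        (fun k y => (s k).robust_le y (γ.rule k (y, ρ.rule k y))) hn x
    exact iInf_le_of_le ρ (iSup_le fun γ => EReal.coe_le_coe (hupper γ))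
  · intro γ hγ n hn x
    refine le_antisymm ?_ (le_iSup (fun γ => RobustMDP.naturePolicyValue γ n x) γ)
    rw [hnature n hn x]
    exact hlower γ hγ n hn x
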